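/- Conventions. A hypergraph $H$ consists of finite nonempty sets $V(H)$ (vertices) and $E(H)$ (hyperedges, possibly repeated), each hyperedge being a nonempty subset of $V(H)$, with every vertex lying in some hyperedge. A path of length $n$ in $H$ is a sequence $(v_0,e_1,v_1,\dots,e_n,v_n)$ with $v_{i-1},v_i\in e_i$ for all $i$; $H$ is connected if any two vertices are joined by a path. A cycle is a path with $n>1$ and $v_n=v_0$. A path has backtracking if it contains consecutive terms $(e,v,e)$ or $(v,e,v)$. A cycle $C$ is prime if neither $C$ nor $C^2$ has backtracking and $C$ is not $D^m$ for a cycle $D$ and $m>1$; $[C]$ denotes the class of $C$ under change of initial vertex and $\ell(C)$ its length. The Ihara zeta function of $H$ is $\zeta_H(u)=\prod_{[C]}(1-u^{\ell(C)})^{-1}$, the product over all classes of prime cycles of $H$. A group $G$ acts freely on a hypergraph $Y$ if it acts by automorphisms (incidence-preserving pairs of permutations of $V(Y)$ and $E(Y)$), freely on $V(Y)$ and on $E(Y)$, and $v\in e$ implies $gv\notin e$ for all $g\ne 1$. The quotient $Y/G$ has the $G$-orbits of vertices and of hyperedges as its vertices and hyperedges, with $[e]=\{[v]: v\in e\}$.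 A morphism $\pi:Y\to X$ of hypergraphs (a pair of maps on vertices and on hyperedges preserving incidence) is a free Galois covering with Galois group $G$ if $G$ acts freely on $Y$, $X$ is isomorphic to $Y/G$ so that $\pi$ becomes the projection, and $G\cong\{\sigma\in\mathrm{Aut}(Y):\pi\circ\sigma=\pi\}$. Let $Y$ be connected and $\pi:Y\to X$ a free Galois covering with Galois group $G$. Let $B_X$ be the bipartite graph on $V(X)\sqcup E(X)$ in which $v$ and $e$ are adjacent iff $v\in e$. Choose a spanning tree $T$ of $B_X$, a vertex $v_0$ of $X$ and a vertex $v_0'$ of $Y$ with $\pi(v_0')=v_0$. The identity sheet consists of the terminal vertices of the lifts to $Y$, starting at $v_0'$, of the paths of $X$ from $v_0$ to the vertices of $X$ that correspond to the simple paths in $T$. Each vertex $v$ of $Y$ is $gv'$ for a unique $g\in G$ and a $v'$ in the identity sheet; $g$ is the sheet number of $v$. For a prime cycle $C$ of $X$, the Frobenius element $F(C,Y/X)\in G$ is the sheet number of the terminal vertex of the unique lift of $C$ to $Y$ whose initial vertex has sheet number $1$. For a finite-dimensional complex representation $\rho$ of $G$ put $$L(u,\rho,Y/X)=\prod_{[C]}\det\bigl(1-\rho(F(C,Y/X))\,u^{\ell(C)}\bigr)^{-1},$$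 the product over the classes of prime cycles of $X$, with one representative $C$ chosen in each class. Statement. Let $Y$ be a connected hypergraph, $\pi:Y\to X$ a free Galois covering of hypergraphs with Galois group $G$, and $\widehat G$ a complete set of inequivalent irreducible complex representations of $G$. Then for all complex $u$ with $|u|$ sufficiently small, the products defining $\zeta_Y(u)$ and $L(u,\rho,Y/X)$ ($\rho\in\widehat G$) converge unconditionally and $$\zeta_Y(u)=\prod_{\rho\in\widehat G}L(u,\rho,Y/X)^{d_\rho},$$ where $d_\rho=\dim\rho$. This holds for every choice of spanning tree, base vertex, lift and representatives of the classes of prime cycles, and the choices may differ from one $\rho$ to another. -/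

import Mathlib

/-- A finite hypergraph with vertex set `V` and (possibly repeated) hyperedges indexed by `E`:
`V` and `E` are finite and nonempty, each hyperedge is a nonempty set of vertices, and the
hyperedges cover `V`. -/
structure MultiHypergraph (V E : Type*) where
  finite_vertices : Finite V
  finite_edges : Finite E
  nonempty_vertices : Nonempty V
  nonempty_edges : Nonempty E
  /-- the set of vertices incident to a hyperedge -/
  verts : E → Set V
  verts_nonempty : ∀ e, (verts e).Nonempty
  cover : ∀ v, ∃ e, v ∈ verts e

namespace MultiHypergraph

section Basic

variable {V E V₁ E₁ V₂ E₂ : Type*}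

/-! ### Paths and prime cycles -/

/-- The path `(v₀, e₁, v₁, e₂, v₂, …, eₙ, vₙ)` is encoded by its initial vertex `v₀` and the list
of steps `[(e₁, v₁), …, (eₙ, vₙ)]`. This predicate says that it is a path of `H`, i.e. that
`v_{i-1} ∈ e_i` and `v_i ∈ e_i` for all `i`. Its length is the length of the list of steps. -/
def IsPath (H : MultiHypergraph V E) : V → List (E × V) → Prop
  | _, [] => True
  | v, (e, w) :: l => v ∈ H.verts e ∧ w ∈ H.verts e ∧ H.IsPath w l

/-- The terminal vertex of the path with initial vertex `v` and list of steps `l`. -/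
def terminal : V → List (E × V) → V
  | v, [] => v
  | _, (_, w) :: l => terminal w l

/-- Any two vertices are joined by a path. -/
def Connected (H : MultiHypergraph V E) : Prop :=
  ∀ v w, ∃ l, H.IsPath v l ∧ terminal v l = w

/-- A cycle (closed path): a path of length `> 1` whose initial and terminal vertices agree. -/
def IsCycle (H : MultiHypergraph V E) (v : V) (l : List (E × V)) : Prop :=
  H.IsPath v l ∧ terminal v l = v ∧ 1 < l.length

/-- The path has no backtracking: it contains neither a subsequence `(e, v, e)` (two consecutive
hyperedges are distinct) nor a subsequence `(v, e, v)` (two consecutive vertices are distinct). -/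
def NoBacktracking (v : V) (l : List (E × V)) : Prop :=
  (l.map Prod.fst).IsChain (· ≠ ·) ∧ (v :: l.map Prod.snd).IsChain (· ≠ ·)

/-- The steps of the closed path obtained by going `n` times around a closed path. -/
def power (l : List (E × V)) (n : ℕ) : List (E × V) :=
  (List.replicate n l).flatten

/-- A prime cycle: a cycle without backtracking and without tail (its square has no backtracking)
that is not a proper power of a cycle. -/
def IsPrimeCycle (H : MultiHypergraph V E) (v : V) (l : List (E × V)) : Prop :=
  H.IsCycle v l ∧ NoBacktracking v l ∧ NoBacktracking v (power l 2) ∧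
    ∀ (d : List (E × V)) (n : ℕ), 1 < n → H.IsCycle v d → l ≠ power d n

/-- The type of prime cycles of `H`. -/
structure PrimeCycle (H : MultiHypergraph V E) where
  start : V
  steps : List (E × V)
  isPrimeCycle : H.IsPrimeCycle start steps

/-- Two prime cycles are equivalent if one is obtained from the other by changing the initial
vertex. As the initial vertex of a closed path is the last vertex of its list of steps, this means
that the lists of steps are cyclic rotations of each other. -/
def primeCycleSetoid (H : MultiHypergraph V E) : Setoid H.PrimeCycle where
  r C D := C.steps ~r D.steps
  iseqv := ⟨fun C => List.IsRotated.refl C.steps, fun h => h.symm, fun h k => h.trans k⟩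

/-- The type of equivalence classes `[C]` of prime cycles of `H`. -/
def PrimeClass (H : MultiHypergraph V E) : Type _ := Quotient H.primeCycleSetoid

/-- The length `ℓ(C)` of a prime cycle, as a function of the class `[C]`. -/
def PrimeClass.length {H : MultiHypergraph V E} (c : H.PrimeClass) : ℕ :=
  Quotient.lift (fun C : H.PrimeCycle => C.steps.length)
    (fun _ _ h => List.Perm.length_eq (List.IsRotated.perm h)) c

/-- The Euler factor `(1 - u ^ ℓ(C))⁻¹` of the Ihara zeta function at the class `[C]`. -/
noncomputable def zetaFactor (H : MultiHypergraph V E) (u : ℂ) (c : H.PrimeClass) : ℂ :=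
  (1 - u ^ c.length)⁻¹

/-- The Ihara zeta function `ζ_H(u) = ∏_{[C]} (1 - u ^ ℓ(C))⁻¹`. -/
noncomputable def zeta (H : MultiHypergraph V E) (u : ℂ) : ℂ :=
  ∏' c : H.PrimeClass, H.zetaFactor u c

/-! ### Morphisms, isomorphisms, and the associated bipartite graph -/

/-- A morphism of hypergraphs: a pair of maps preserving incidence. -/
structure Hom (H₁ : MultiHypergraph V₁ E₁) (H₂ : MultiHypergraph V₂ E₂) where
  onV : V₁ → V₂
  onE : E₁ → E₂
  map_mem : ∀ v e, v ∈ H₁.verts e → onV v ∈ H₂.verts (onE e)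

/-- An isomorphism of hypergraphs. -/
structure Iso (H₁ : MultiHypergraph V₁ E₁) (H₂ : MultiHypergraph V₂ E₂) where
  onV : V₁ ≃ V₂
  onE : E₁ ≃ E₂
  map_mem_iff : ∀ v e, onV v ∈ H₂.verts (onE e) ↔ v ∈ H₁.verts e

/-- The image under a morphism of the list of steps of a path. -/
def Hom.mapSteps {H₁ : MultiHypergraph V₁ E₁} {H₂ : MultiHypergraph V₂ E₂} (φ : H₁.Hom H₂)
    (l : List (E₁ × V₁)) : List (E₂ × V₂) :=
  l.map (Prod.map φ.onE φ.onV)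

/-- The bipartite graph `B_H` on `V ⊔ E`, in which `v` and `e` are adjacent iff `v ∈ e`. -/
def bipartite (H : MultiHypergraph V E) : SimpleGraph (V ⊕ E) where
  Adj
    | .inl v, .inr e => v ∈ H.verts e
    | .inr e, .inl v => v ∈ H.verts e
    | _, _ => False
  symm := ⟨by rintro (v | e) (w | f) h <;> exact h⟩
  loopless := ⟨by rintro (v | e) h <;> exact h⟩

/-- The walk `v₀, e₁, v₁, …, eₙ, vₙ` on `V ⊔ E` that corresponds to a path only uses edges of the
graph `T`. -/
def InGraph (T : SimpleGraph (V ⊕ E)) : V → List (E × V) → Prop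
  | _, [] => True
  | v, (e, w) :: l => T.Adj (.inl v) (.inr e) ∧ T.Adj (.inr e) (.inl w) ∧ InGraph T w l

/-- The walk `v₀, e₁, v₁, …, eₙ, vₙ` on `V ⊔ E` visits no vertex of `V ⊔ E` twice. -/
def IsSimple (v : V) (l : List (E × V)) : Prop :=
  (v :: l.map Prod.snd).Nodup ∧ (l.map Prod.fst).Nodup

end Basic

/-! ### Group actions, quotients, and free Galois coverings -/

section Galois

variable {VY EY VX EX : Type*} (G : Type*) [Group G] [MulAction G VY] [MulAction G EY]

/-- The actions of `G` on vertices and on hyperedges form an action of `G` on `Y` by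
automorphisms. -/
def IsAction (Y : MultiHypergraph VY EY) : Prop :=
  ∀ (g : G) (v : VY) (e : EY), g • v ∈ Y.verts (g • e) ↔ v ∈ Y.verts e

/-- A free action of `G` on `Y`. -/
structure IsFreeAction (Y : MultiHypergraph VY EY) : Prop where
  isAction : Y.IsAction G
  free_vertices : ∀ (g : G) (v : VY), g • v = v → g = 1
  free_edges : ∀ (g : G) (e : EY), g • e = e → g = 1
  smul_notMem : ∀ (v : VY) (e : EY), v ∈ Y.verts e → ∀ g : G, g ≠ 1 → g • v ∉ Y.verts e

/-- The quotient hypergraph `Y/G`: its vertices and hyperedges are the `G`-orbits of vertices and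
of hyperedges of `Y`, and the hyperedge `[e]` is the set `{[v] | v ∈ e}`. -/
def quotient (Y : MultiHypergraph VY EY) :
    MultiHypergraph (MulAction.orbitRel.Quotient G VY) (MulAction.orbitRel.Quotient G EY) where
  finite_vertices := by
    have := Y.finite_vertices
    exact Quotient.finite _
  finite_edges := by
    have := Y.finite_edges
    exact Quotient.finite _
  nonempty_vertices := Y.nonempty_vertices.map (Quotient.mk _)
  nonempty_edges := Y.nonempty_edges.map (Quotient.mk _)
  verts b := {a | ∃ v e, Quotient.mk _ v = a ∧ Quotient.mk _ e = b ∧ v ∈ Y.verts e}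
  verts_nonempty b := by
    induction b using Quotient.inductionOn with
    | h e =>
      obtain ⟨v, hv⟩ := Y.verts_nonempty e
      exact ⟨Quotient.mk _ v, v, e, rfl, rfl, hv⟩
  cover a := by
    induction a using Quotient.inductionOn with
    | h v =>
      obtain ⟨e, he⟩ := Y.cover v
      exact ⟨Quotient.mk _ e, v, e, rfl, rfl, he⟩

/-- The group `{σ ∈ Aut(Y) | π ∘ σ = π}` of deck transformations of a morphism `π : Y → X`. -/
def deckGroup {Y : MultiHypergraph VY EY} {X : MultiHypergraph VX EX} (π : Y.Hom X) :
    Subgroup (Equiv.Perm VY × Equiv.Perm EY) where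
  carrier := {σ | (∀ v e, σ.1 v ∈ Y.verts (σ.2 e) ↔ v ∈ Y.verts e) ∧
    (∀ v, π.onV (σ.1 v) = π.onV v) ∧ ∀ e, π.onE (σ.2 e) = π.onE e}
  mul_mem' := by
    rintro σ τ ⟨h1, h2, h3⟩ ⟨k1, k2, k3⟩
    exact ⟨fun v e => (h1 _ _).trans (k1 v e), fun v => (h2 _).trans (k2 v),
      fun e => (h3 _).trans (k3 e)⟩
  one_mem' := ⟨fun _ _ => Iff.rfl, fun _ => rfl, fun _ => rfl⟩
  inv_mem' := by
    rintro σ ⟨h1, h2, h3⟩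
    refine ⟨fun v e => ?_, fun v => ?_, fun e => ?_⟩
    · simpa using (h1 (σ⁻¹.1 v) (σ⁻¹.2 e)).symm
    · simpa using (h2 (σ⁻¹.1 v)).symm
    · simpa using (h3 (σ⁻¹.2 e)).symm

/-- `π : Y → X` is a free Galois covering with Galois group `G`: `G` acts freely on `Y`, there is
an isomorphism `X ≅ Y/G` under which `π` is the projection, and `G` is isomorphic to the group of
deck transformations of `π`. -/
structure IsFreeGaloisCovering {Y : MultiHypergraph VY EY} {X : MultiHypergraph VX EX}
    (π : Y.Hom X) : Prop where
  isFreeAction : Y.IsFreeAction G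
  exists_iso_quotient : ∃ φ : X.Iso (Y.quotient G),
    (∀ v, φ.onV (π.onV v) = Quotient.mk _ v) ∧ ∀ e, φ.onE (π.onE e) = Quotient.mk _ e
  deckGroup_iso : Nonempty (G ≃* deckGroup π)

end Galois

/-! ### Sheets, Frobenius elements, and Artin-Ihara L-functions -/

section LFunction

variable {VY EY VX EX : Type*} {Y : MultiHypergraph VY EY} {X : MultiHypergraph VX EX}

/-- The choices entering the definition of the Artin-Ihara L-function of `π : Y → X`: a spanning
tree `T` of `B_X`, a vertex `v₀` of `X`, a lift `v₀'` of `v₀` to `Y`, and a representative of each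
class of prime cycles of `X`. -/
structure Choices (π : Y.Hom X) where
  tree : SimpleGraph (VX ⊕ EX)
  tree_le : tree ≤ X.bipartite
  isTree : tree.IsTree
  base : VX
  lift : VY
  lift_eq : π.onV lift = base
  rep : X.PrimeClass → X.PrimeCycle
  rep_eq : ∀ c, Quotient.mk X.primeCycleSetoid (rep c) = c

/-- The sheet of the identity: the terminal vertices of the lifts to `Y`, with initial vertex
`v₀'`, of the paths of `X` that start at `v₀` and correspond to simple paths in the tree `T`. -/
def Choices.identitySheet {π : Y.Hom X} (S : Choices π) : Set VY :=
  {v | ∃ l, Y.IsPath S.lift l ∧ terminal S.lift l = v ∧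
    InGraph S.tree S.base (π.mapSteps l) ∧ IsSimple S.base (π.mapSteps l)}

variable (G : Type*) [Group G] [MulAction G VY]

/-- The sheet number of a vertex `v` of `Y`: the (unique, for a free Galois covering of a
connected hypergraph) `g ∈ G` with `v = g v'` for some `v'` in the sheet of the identity. -/
noncomputable def Choices.sheetNumber {π : Y.Hom X} (S : Choices π) (v : VY) : G :=
  Classical.epsilon fun g : G => ∃ w ∈ S.identitySheet, g • w = v

/-- The Frobenius element `F(C, Y/X)` of a path `C` of `X`: the sheet number of the terminal vertex
of the (unique) lift of `C` to `Y` whose initial vertex has sheet number `1`. -/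
noncomputable def Choices.frobenius {π : Y.Hom X} (S : Choices π) (v : VX)
    (l : List (EX × VX)) : G :=
  Classical.epsilon fun g : G => ∃ (w : VY) (m : List (EY × VY)), Y.IsPath w m ∧
    π.onV w = v ∧ π.mapSteps m = l ∧ S.sheetNumber G w = 1 ∧ S.sheetNumber G (terminal w m) = g

variable {G} {W : Type*} [AddCommGroup W] [Module ℂ W]

/-- The Euler factor `det(1 - ρ(F(C, Y/X)) u ^ ℓ(C))⁻¹` at the class `[C]`. -/
noncomputable def Choices.LFactor {π : Y.Hom X} (S : Choices π) (ρ : Representation ℂ G W)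
    (u : ℂ) (c : X.PrimeClass) : ℂ :=
  (LinearMap.det
    (1 - u ^ c.length • ρ (S.frobenius G (S.rep c).start (S.rep c).steps)))⁻¹

/-- The Artin-Ihara L-function `L(u, ρ, Y/X) = ∏_{[C]} det(1 - ρ(F(C, Y/X)) u ^ ℓ(C))⁻¹`. -/
noncomputable def Choices.LFunction {π : Y.Hom X} (S : Choices π) (ρ : Representation ℂ G W)
    (u : ℂ) : ℂ :=
  ∏' c : X.PrimeClass, S.LFactor ρ u c

end LFunction

end MultiHypergraph

/-- `(ρ i)` is a complete set of inequivalent irreducible complex representations of `G`. (A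
finite-dimensional representation in any universe is equivalent to one on some `Fin n → ℂ`, so it
is enough to quantify over `Type`.) -/
structure IsCompleteSetOfIrreps {G : Type*} [Group G] {ι : Type*} {W : ι → Type*}
    [∀ i, AddCommGroup (W i)] [∀ i, Module ℂ (W i)] (ρ : ∀ i, Representation ℂ G (W i)) :
    Prop where
  irreducible : ∀ i, (ρ i).IsIrreducible
  inequivalent : ∀ i j, i ≠ j → IsEmpty ((ρ i).Equiv (ρ j))
  complete : ∀ (U : Type) [AddCommGroup U] [Module ℂ U] [FiniteDimensional ℂ U]
    (σ : Representation ℂ G U), σ.IsIrreducible → ∃ i, Nonempty ((ρ i).Equiv σ)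

/-! The identity is proved one Euler factor at a time, over each class `c` of prime cycles of `X`.

Geometric side. A closed path without backtracking or tail is a closed walk in the digraph of flags
`(e, v)` with arrows `Arrow`, and a prime cycle is a closed walk whose word is primitive. On flags,
`π` is a covering with free `G`-action (`isWalkCovering`), so lifts are unique. If `g` is the
monodromy of a prime word `l` and `f` is the order of `g`, then `l ^ f` is the first power whose
lift closes up. That closed lift is prime, its `G`-translates give all primes above `l`, and two
translates agree up to rotation exactly when they lie in the same left coset of `⟨g⟩`. Hence the
classes above `c` are indexed by `G ⧸ ⟨g⟩` and all have length `f * ℓ(c)`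
(`exists_primeClass_equiv`).

Algebraic side. Left multiplication by `g` on `ℂ[G]` consists of `|G| / f` cyclic shifts of size
`f`, so its determinant factor at `t` is `(1 - t ^ f) ^ (|G| / f)`. Decomposing `ℂ[G]` into
irreducibles, each as often as its dimension, gives the product of the local factors of the
L-functions (`prod_det_pow_finrank`). With `t = u ^ ℓ(c)` both sides agree.

The Frobenius element is one of the monodromies of `c` (`isMonodromy_frobenius`), and these are all
conjugate, so the determinants do not depend on the choices. Counting words over a finite alphabet
gives convergence near `0`, and the product over primes of `Y` is then regrouped along the fibres
over primes of `X`. -/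

/-! ### Block determinants and the cyclic shift. -/

section Determinants

/-- The determinant of a block-diagonal endomorphism of a finite product is the product of the
determinants of the blocks. -/
theorem LinearMap.det_pi_dependent {R J : Type*} [CommRing R] [Fintype J] [LinearOrder J]
    {M : J → Type*}
    [∀ j, AddCommGroup (M j)] [∀ j, Module R (M j)] [∀ j, Module.Free R (M j)]
    [∀ j, Module.Finite R (M j)] (f : ∀ j, M j →ₗ[R] M j) :
    LinearMap.det (LinearMap.pi fun j => f j ∘ₗ LinearMap.proj j) =
      ∏ j, LinearMap.det (f j) := by
  classical
  let b := fun j => Module.Free.chooseBasis R (M j)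
  rw [← LinearMap.det_toMatrix (Pi.basis b)]
  simp_rw [← LinearMap.det_toMatrix (b _)]
  rw [Matrix.BlockTriangular.det_fintype (b := Sigma.fst)]
  · refine Finset.prod_congr rfl fun j _ => ?_
    rw [← Matrix.det_reindex_self (Equiv.sigmaSubtype j)]
    congr 1
    ext x y
    simp [Matrix.toSquareBlock, Matrix.toSquareBlockProp, LinearMap.toMatrix_apply, Pi.basis_repr,
      Pi.basis_apply, Equiv.sigmaSubtype]
  · rintro ⟨i, x⟩ ⟨j, y⟩ h
    rw [LinearMap.toMatrix_apply, Pi.basis_repr, Pi.basis_apply]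
    simp [Pi.single_eq_of_ne (ne_of_gt h)]

/-- The trace of a block-diagonal endomorphism of a finite product is the sum of the traces of the
blocks. -/
theorem LinearMap.trace_pi_dependent {R J : Type*} [CommRing R] [Fintype J] {M : J → Type*}
    [∀ j, AddCommGroup (M j)] [∀ j, Module R (M j)] [∀ j, Module.Free R (M j)]
    [∀ j, Module.Finite R (M j)] (f : ∀ j, M j →ₗ[R] M j) :
    LinearMap.trace R _ (LinearMap.pi fun j => f j ∘ₗ LinearMap.proj j) =
      ∑ j, LinearMap.trace R _ (f j) := by
  classical
  let b := fun j => Module.Free.chooseBasis R (M j)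
  rw [LinearMap.trace_eq_matrix_trace R (Pi.basis b)]
  simp_rw [LinearMap.trace_eq_matrix_trace R (b _), Matrix.trace, Fintype.sum_sigma]
  refine Finset.sum_congr rfl fun j _ => Finset.sum_congr rfl fun x _ => ?_
  simp [LinearMap.toMatrix_apply, Pi.basis_repr, Pi.basis_apply]

theorem IsPrimitiveRoot.prod_one_sub_mul_pow {ζ : ℂ} {f : ℕ} (hf : 0 < f)
    (hζ : IsPrimitiveRoot ζ f) (t : ℂ) : ∏ k : Fin f, (1 - t * ζ ^ (k : ℕ)) = 1 - t ^ f := by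
  have h := hζ.pow_sub_pow_eq_prod_sub_mul (1 : ℂ) t hf
  rw [one_pow] at h
  rw [h]
  refine Finset.prod_nbij (fun k : Fin f => ζ ^ (k : ℕ)) ?_ ?_ ?_ ?_
  · intro k _
    rw [Polynomial.mem_nthRootsFinset hf, ← pow_mul, mul_comm, pow_mul, hζ.pow_eq_one, one_pow]
  · intro k _ l _ hkl
    exact Fin.ext (hζ.pow_inj k.2 l.2 hkl)
  · intro x hx
    have : NeZero f := ⟨hf.ne'⟩
    obtain ⟨i, hi, hix⟩ := hζ.eq_pow_of_pow_eq_one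
      ((Polynomial.mem_nthRootsFinset hf (1 : ℂ)).1 (Finset.mem_coe.1 hx))
    exact ⟨⟨i, hi⟩, by simp, hix⟩
  · intro k _
    rw [mul_comm]

/-- The characteristic determinant of the regular representation of a cyclic group at a
generator. -/
theorem Matrix.det_one_sub_smul_cyclic {G : Type*} [Group G] [DecidableEq G] (g : G)
    (hg : 0 < orderOf g) (t : ℂ) :
    (1 - t • Matrix.of fun i j : Fin (orderOf g) =>
      if g ^ (j : ℕ) = g ^ (i : ℕ) * g then (1 : ℂ) else 0).det = 1 - t ^ orderOf g := by
  obtain ⟨ζ, hζ⟩ : ∃ ζ : ℂ, IsPrimitiveRoot ζ (orderOf g) :=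
    ⟨_, Complex.isPrimitiveRoot_exp _ hg.ne'⟩
  set C := Matrix.of fun i j : Fin (orderOf g) =>
      if g ^ (j : ℕ) = g ^ (i : ℕ) * g then (1 : ℂ) else 0 with hC
  -- Fourier matrix: its `k`-th column is `(ζ ^ (k * i))` over `i`, an eigenvector of the shift `C`
  -- with eigenvalue `ζ ^ k`. Distinct eigenvalues make it invertible.
  set V : Matrix (Fin (orderOf g)) (Fin (orderOf g)) ℂ :=
    (Matrix.vandermonde fun k : Fin (orderOf g) => ζ ^ (k : ℕ)).transpose with hV
  have hdet : V.det ≠ 0 := by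
    rw [hV, Matrix.det_transpose, Matrix.det_vandermonde_ne_zero_iff]
    exact fun k l hkl => Fin.ext (hζ.pow_inj k.2 l.2 hkl)
  have hCV : C * V = V * Matrix.diagonal fun k : Fin (orderOf g) => ζ ^ (k : ℕ) := by
    ext i k
    rw [Matrix.mul_apply, Matrix.mul_diagonal]
    rw [Finset.sum_eq_single
      (⟨(i + 1) % orderOf g, Nat.mod_lt _ hg⟩ : Fin (orderOf g))]
    · simp only [hV, Matrix.transpose_apply, Matrix.vandermonde_apply]
      have h1 : C i ⟨(i + 1) % orderOf g, Nat.mod_lt _ hg⟩ = 1 :=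
        if_pos (by rw [pow_mod_orderOf, pow_succ])
      rw [h1, one_mul, ← pow_succ, ← pow_mul, ← pow_mul,
        mul_comm, mul_comm (k : ℕ), pow_mul, pow_mul]
      congr 1
      exact pow_eq_pow_mod _ hζ.pow_eq_one |>.symm
    · intro j _ hj
      have h1 : C i j = 0 := if_neg fun h => by
        apply hj
        rw [← pow_succ, ← pow_mod_orderOf g (i + 1)] at h
        exact Fin.ext (pow_injOn_Iio_orderOf j.2 (Nat.mod_lt _ hg) h)
      rw [h1, zero_mul]
    · simp
  have h : (1 - t • C) * V =
      V * Matrix.diagonal fun k : Fin (orderOf g) => 1 - t * ζ ^ (k : ℕ) := by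
    have : (Matrix.diagonal fun k : Fin (orderOf g) => 1 - t * ζ ^ (k : ℕ)) =
        1 - t • Matrix.diagonal fun k : Fin (orderOf g) => ζ ^ (k : ℕ) := by
      rw [← Matrix.diagonal_one, ← Matrix.diagonal_smul, Matrix.diagonal_sub]
      rfl
    rw [this, sub_mul, mul_sub, one_mul, mul_one, smul_mul_assoc, hCV, mul_smul_comm]
  have h2 := congrArg Matrix.det h
  rw [Matrix.det_mul, Matrix.det_mul, mul_comm, Matrix.det_diagonal,
    hζ.prod_one_sub_mul_pow hg] at h2
  exact mul_left_cancel₀ hdet h2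

end Determinants

/-! ### Decomposition of the regular representation. -/

section RegularRepresentation

open Representation
open scoped MonoidAlgebra

/-- A linear isomorphism that intertwines a representation with a `k[G]`-module is an isomorphism
of `k[G]`-modules. -/
noncomputable def Representation.asModuleEquivOfIntertwines {k G V M : Type*} [Field k] [Group G]
    [AddCommGroup V] [Module k V] (ρ : Representation k G V) [AddCommGroup M] [Module k M]
    [Module k[G] M] [IsScalarTower k k[G] M] (e : V ≃ₗ[k] M)
    (he : ∀ g v, e (ρ g v) = MonoidAlgebra.of k G g • e v) : ρ.asModule ≃ₗ[k[G]] M where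
  toAddEquiv := (ρ.asModuleEquiv.trans e).toAddEquiv
  map_smul' r x := by
    show e (ρ.asModuleEquiv (r • x)) = r • e (ρ.asModuleEquiv x)
    rw [asModuleEquiv_map_smul]
    induction r using MonoidAlgebra.induction_on with
    | of g => rw [asAlgebraHom_of, he]
    | add a b ha hb => rw [map_add, LinearMap.add_apply, map_add, ha, hb, add_smul]
    | smul c a ha => rw [map_smul, LinearMap.smul_apply, map_smul, ha, smul_assoc]

/-- Completeness only speaks of representations on spaces in `Type`, so `M`, which may live in any
universe, is first transported to `Fin n → ℂ` by a basis. -/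
theorem IsCompleteSetOfIrreps.exists_linearEquiv_of_isSimpleModule {G : Type*} [Group G]
    {ι : Type*} {W : ι → Type*} [∀ i, AddCommGroup (W i)] [∀ i, Module ℂ (W i)]
    {ρ : ∀ i, Representation ℂ G (W i)} (hρ : IsCompleteSetOfIrreps ρ) (M : Type*)
    [AddCommGroup M] [Module ℂ M] [Module ℂ[G] M] [IsScalarTower ℂ ℂ[G] M]
    [FiniteDimensional ℂ M] [IsSimpleModule ℂ[G] M] :
    ∃ (i : ι) (e : M ≃ₗ[ℂ] W i), ∀ g x, e (MonoidAlgebra.of ℂ G g • x) = ρ i g (e x) := by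
  let b := (Module.finBasis ℂ M).equivFun
  let τ : Representation ℂ G M := ofModule' M
  have hτ : ∀ g x, τ g x = MonoidAlgebra.of ℂ G g • x := fun g x => by
    simp [τ, ofModule']
  let σ : Representation ℂ G (Fin (Module.finrank ℂ M) → ℂ) :=
    { toFun := fun g => b.conj (τ g)
      map_one' := by rw [map_one]; exact b.conj_id
      map_mul' := fun g h => by rw [map_mul]; exact b.conj_comp _ _ }
  have hσ : ∀ g v, b.symm (σ g v) = MonoidAlgebra.of ℂ G g • b.symm v := fun g v => by
    show b.symm (b.conj (τ g) v) = _
    rw [LinearEquiv.conj_apply_apply, LinearEquiv.symm_apply_apply, hτ]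
  have : IsSimpleModule ℂ[G] σ.asModule :=
    IsSimpleModule.congr (σ.asModuleEquivOfIntertwines b.symm hσ)
  obtain ⟨i, ⟨φ⟩⟩ := hρ.complete _ σ ((irreducible_iff_isSimpleModule_asModule σ).2 this)
  refine ⟨i, b.trans φ.toLinearEquiv.symm, fun g x => ?_⟩
  have h1 : b (MonoidAlgebra.of ℂ G g • x) = σ g (b x) := by
    apply b.symm.injective
    rw [hσ, LinearEquiv.symm_apply_apply, LinearEquiv.symm_apply_apply]
  rw [LinearEquiv.trans_apply, h1, LinearEquiv.trans_apply]
  exact IntertwiningMap.isIntertwining _ _ φ.symm.toIntertwiningMap g (b x)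

/-- The regular representation of a finite group is a direct sum of members of a complete set of
irreducible representations. -/
theorem IsCompleteSetOfIrreps.exists_leftRegular_equiv_pi {G : Type*} [Group G] [Finite G]
    {ι : Type*} {W : ι → Type*} [∀ i, AddCommGroup (W i)] [∀ i, Module ℂ (W i)]
    {ρ : ∀ i, Representation ℂ G (W i)} (hρ : IsCompleteSetOfIrreps ρ) :
    ∃ (n : ℕ) (σ : Fin n → ι) (e : ℂ[G] ≃ₗ[ℂ] (∀ j, W (σ j))), ∀ g x,
      e (leftRegular ℂ G g x) = fun j => ρ (σ j) g (e x j) := by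
  -- The hypothesis of Maschke's theorem, which makes `ℂ[G]` semisimple.
  have : NeZero (Nat.card G : ℂ) := ⟨by exact_mod_cast Nat.card_pos.ne'⟩
  obtain ⟨n, S, e, hS⟩ := IsSemisimpleModule.exists_linearEquiv_fin_dfinsupp ℂ[G] ℂ[G]
  have : FiniteDimensional ℂ ℂ[G] := inferInstance
  have hfin : ∀ j, FiniteDimensional ℂ (S j) := fun j =>
    inferInstanceAs (FiniteDimensional ℂ ((S j).restrictScalars ℂ))
  choose σ E hE using fun j => hρ.exists_linearEquiv_of_isSimpleModule (S j)
  refine ⟨n, σ, (e.restrictScalars ℂ).trans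
    ((DFinsupp.linearEquivFunOnFintype (R := ℂ)).trans (LinearEquiv.piCongrRight E)), ?_⟩
  intro g x
  have h1 : leftRegular ℂ G g x = MonoidAlgebra.of ℂ G g • x := by
    rw [smul_eq_mul, ← asAlgebraHom_ofMulAction_smul_eq_mul, asAlgebraHom_of]
  rw [h1]
  ext j
  show E j (e (MonoidAlgebra.of ℂ G g • x) j) = ρ (σ j) g (E j (e x j))
  rw [← hE, map_smul]
  rfl

/-- Left multiplication by `g` permutes the basis `G` freely in cycles of length `orderOf g`, one
for each coset of `⟨g⟩`, so the matrix is block diagonal with equal cyclic blocks. -/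
theorem Representation.det_one_sub_smul_leftRegular {G : Type*} [Group G] [Finite G] (g : G)
    (t : ℂ) : LinearMap.det (1 - t • leftRegular ℂ G g) =
      (1 - t ^ orderOf g) ^ Nat.card (G ⧸ Subgroup.zpowers g) := by
  classical
  have := Fintype.ofFinite G
  have hfin : IsOfFinOrder g := isOfFinOrder_of_finite g
  let F : Fin (orderOf g) × (G ⧸ Subgroup.zpowers g) → G := fun p => p.2.out * g ^ (p.1 : ℕ)
  have hFmk : ∀ p, (F p : G ⧸ Subgroup.zpowers g) = p.2 := fun p => by
    rw [QuotientGroup.mk_mul_of_mem _ (Subgroup.npow_mem_zpowers g p.1)]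
    exact Quotient.out_eq _
  have hF : F.Bijective := by
    refine ⟨fun p p' h => ?_, fun x => ?_⟩
    · have h2 : p.2 = p'.2 := by rw [← hFmk p, ← hFmk p', h]
      refine Prod.ext (Fin.ext (pow_injOn_Iio_orderOf p.1.2 p'.1.2 ?_)) h2
      have h3 : p.2.out * g ^ (p.1 : ℕ) = p'.2.out * g ^ (p'.1 : ℕ) := h
      rw [h2] at h3
      exact mul_left_cancel h3
    · have hx : (QuotientGroup.mk x : G ⧸ Subgroup.zpowers g).out⁻¹ * x ∈
          Subgroup.zpowers g :=
        QuotientGroup.eq.1 (Quotient.out_eq _)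
      rw [← hfin.mem_powers_iff_mem_zpowers, hfin.mem_powers_iff_mem_range_orderOf] at hx
      obtain ⟨k, hk, hkx⟩ := Finset.mem_image.1 hx
      refine ⟨(⟨k, Finset.mem_range.1 hk⟩, QuotientGroup.mk x), ?_⟩
      show _ * g ^ k = x
      rw [hkx, mul_inv_cancel_left]
  let E := _root_.Equiv.ofBijective F hF
  let b : Module.Basis G ℂ ℂ[G] := Module.Basis.ofRepr (MonoidAlgebra.coeffLinearEquiv ℂ)
  -- `E` parametrises left cosets `x⟨g⟩`, while the orbits of left multiplication by `g` are right
  -- cosets. Inverting group elements exchanges the two.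
  let b' := b.reindex ((_root_.Equiv.inv G).trans E.symm)
  rw [← LinearMap.det_toMatrix b']
  have hb' : ∀ p, b' p = MonoidAlgebra.single (E p)⁻¹ 1 := fun p => by
    simp [b', b, MonoidAlgebra.coeffLinearEquiv]
  have hM : LinearMap.toMatrix b' b' (1 - t • leftRegular ℂ G g) =
      Matrix.blockDiagonal fun _ : G ⧸ Subgroup.zpowers g =>
        (1 - t • Matrix.of fun i j : Fin (orderOf g) =>
          if g ^ (j : ℕ) = g ^ (i : ℕ) * g then (1 : ℂ) else 0) := by
    have hentry : ∀ p p', E p' = E p * g ↔ p.2 = p'.2 ∧ g ^ (p'.1 : ℕ) = g ^ (p.1 : ℕ) * g := by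
      intro p p'
      constructor
      · intro h
        have h2 : p.2 = p'.2 := by
          rw [← hFmk p, ← hFmk p', show F p' = F p * g from h,
            QuotientGroup.mk_mul_of_mem _ (Subgroup.mem_zpowers g)]
        refine ⟨h2, ?_⟩
        have h3 : p'.2.out * g ^ (p'.1 : ℕ) = p.2.out * g ^ (p.1 : ℕ) * g := h
        rw [h2, mul_assoc] at h3
        exact mul_left_cancel h3
      · rintro ⟨h2, h3⟩
        show p'.2.out * g ^ (p'.1 : ℕ) = p.2.out * g ^ (p.1 : ℕ) * g
        rw [h2, h3, mul_assoc]
    ext p p'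
    rw [LinearMap.toMatrix_apply, hb', LinearMap.sub_apply, Module.End.one_apply,
      LinearMap.smul_apply, ofMulAction_single, map_sub, map_smul, Matrix.blockDiagonal_apply]
    have h1 : b'.repr (MonoidAlgebra.single (E p')⁻¹ 1) p = if p = p' then 1 else 0 := by
      rw [← hb', Module.Basis.repr_self, Finsupp.single_apply]
      simp only [eq_comm]
    have h2 : b'.repr (MonoidAlgebra.single (g • (E p')⁻¹) 1) p =
        if E p' = E p * g then 1 else 0 := by
      simp only [b', b, Module.Basis.repr_reindex, Finsupp.mapDomain_equiv_apply]
      simp [MonoidAlgebra.coeffLinearEquiv, Finsupp.single_apply, mul_inv_eq_iff_eq_mul,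
        eq_inv_mul_iff_mul_eq]
      simp only [eq_comm]
    simp only [Finsupp.coe_sub, Finsupp.coe_smul, Pi.sub_apply, Pi.smul_apply, h1, h2, hentry]
    by_cases hp : p.2 = p'.2
    · simp [hp, Matrix.one_apply, Prod.ext_iff]
    · simp [hp, Prod.ext_iff]
  rw [hM, Matrix.det_blockDiagonal, Finset.prod_const, Finset.card_univ,
    Matrix.det_one_sub_smul_cyclic g (orderOf_pos g), Nat.card_eq_fintype_card]

open Classical in
/-- The multiplicity of an irreducible representation in the regular representation is its
dimension. -/
theorem IsCompleteSetOfIrreps.card_eq_finrank {G : Type*} [Group G] [Finite G]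
    {ι : Type*} {W : ι → Type*} [∀ i, AddCommGroup (W i)] [∀ i, Module ℂ (W i)]
    [∀ i, FiniteDimensional ℂ (W i)]
    {ρ : ∀ i, Representation ℂ G (W i)} (hρ : IsCompleteSetOfIrreps ρ) {n : ℕ} (σ : Fin n → ι)
    (e : ℂ[G] ≃ₗ[ℂ] (∀ j, W (σ j)))
    (he : ∀ g x, e (leftRegular ℂ G g x) = fun j => ρ (σ j) g (e x j)) (i : ι) :
    (Finset.univ.filter fun j => σ j = i).card = Module.finrank ℂ (W i) := by
  have := Fintype.ofFinite G
  have hconj : ∀ g, e.conj (leftRegular ℂ G g) =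
      LinearMap.pi fun j => ρ (σ j) g ∘ₗ LinearMap.proj j := fun g => by
    refine LinearMap.ext fun x => ?_
    rw [LinearEquiv.conj_apply_apply, he]
    ext j
    simp
  have htr : ∀ g, ∑ j, (ρ (σ j)).character g = if g = 1 then (Nat.card G : ℂ) else 0 := fun g => by
    simp_rw [Representation.character]
    rw [← LinearMap.trace_pi_dependent, ← hconj, LinearMap.trace_conj']
    let b : Module.Basis G ℂ ℂ[G] := Module.Basis.ofRepr (MonoidAlgebra.coeffLinearEquiv ℂ)
    have hb : ∀ x, b x = MonoidAlgebra.single x 1 := fun x => by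
      simp [b, MonoidAlgebra.coeffLinearEquiv]
    rw [LinearMap.trace_eq_matrix_trace ℂ b, Matrix.trace]
    simp only [Matrix.diag_apply, LinearMap.toMatrix_apply, hb, ofMulAction_single]
    simp [b, MonoidAlgebra.coeffLinearEquiv, Finsupp.single_apply]
  have hirr := hρ.irreducible
  have hcard : (Nat.card G : ℂ) ≠ 0 := by exact_mod_cast Nat.card_pos.ne'
  have := invertibleOfNonzero hcard
  -- The pairing of the character of `ρ i` with the regular character. Orthonormality counts the
  -- summands isomorphic to `ρ i`; since the regular character is `|G|` at `1` and `0` elsewhere,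
  -- the pairing is also the dimension.
  have hsum : (Nat.card G : ℂ)⁻¹ * ∑ g : G, (ρ i).character g * ∑ j, (ρ (σ j)).character g⁻¹ =
      ∑ j, if σ j = i then 1 else 0 := by
    simp_rw [Finset.mul_sum]
    rw [Finset.sum_comm]
    refine Finset.sum_congr rfl fun j _ => ?_
    rw [← Finset.mul_sum, char_orthonormal]
    refine if_congr ⟨fun h => ?_, ?_⟩ rfl rfl
    · by_contra hne
      exact not_isEmpty_iff.2 h (hρ.inequivalent _ _ hne)
    · rintro rfl
      exact ⟨Representation.Equiv.refl _⟩
  simp_rw [htr, inv_eq_one] at hsum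
  rw [Finset.sum_eq_single 1 (by intro g _ hg; simp [hg]) (by simp), if_pos rfl, char_one,
    mul_comm _ (Nat.card G : ℂ), inv_mul_cancel_left₀ hcard, Finset.sum_boole] at hsum
  exact_mod_cast hsum.symm

/-- The local factors of the irreducible representations of `G` at `g` multiply to a power of the
local factor of the trivial representation of the cyclic group generated by `g`. -/
theorem IsCompleteSetOfIrreps.prod_det_pow_finrank {G : Type*} [Group G] [Finite G]
    {ι : Type*} [Fintype ι] {W : ι → Type*} [∀ i, AddCommGroup (W i)] [∀ i, Module ℂ (W i)]
    [∀ i, FiniteDimensional ℂ (W i)]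
    {ρ : ∀ i, Representation ℂ G (W i)} (hρ : IsCompleteSetOfIrreps ρ) (g : G) (t : ℂ) :
    ∏ i, LinearMap.det (1 - t • ρ i g) ^ Module.finrank ℂ (W i) =
      (1 - t ^ orderOf g) ^ Nat.card (G ⧸ Subgroup.zpowers g) := by
  classical
  obtain ⟨n, σ, e, he⟩ := hρ.exists_leftRegular_equiv_pi
  have hconj : e.conj (1 - t • leftRegular ℂ G g) =
      LinearMap.pi fun j => (1 - t • ρ (σ j) g) ∘ₗ LinearMap.proj j := by
    refine LinearMap.ext fun x => ?_
    rw [LinearEquiv.conj_apply_apply]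
    ext j
    simp [he]
  rw [← det_one_sub_smul_leftRegular, ← LinearMap.det_conj _ e]
  have h2 : (e : ℂ[G] →ₗ[ℂ] _) ∘ₗ (1 - t • leftRegular ℂ G g) ∘ₗ
      (e.symm : _ →ₗ[ℂ] ℂ[G]) = LinearMap.pi fun j => (1 - t • ρ (σ j) g) ∘ₗ LinearMap.proj j :=
    hconj
  -- The blocks are grouped by irreducible; the fibre of `σ` over `i` has `finrank` many members.
  rw [h2, LinearMap.det_pi_dependent,
    ← Finset.prod_fiberwise_of_maps_to (g := σ) (t := Finset.univ) (fun _ _ => Finset.mem_univ _)]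
  refine Finset.prod_congr rfl fun i _ => ?_
  rw [← hρ.card_eq_finrank σ e he i, ← Finset.prod_const]
  exact Finset.prod_congr rfl fun j hj => by rw [(Finset.mem_filter.1 hj).2]

end RegularRepresentation

namespace MultiHypergraph

/-! ### Primitive words and rotations. -/

section Words

variable {α β : Type*}

/-- The concatenation of `n` copies of a word. -/
def wordPower (l : List α) (n : ℕ) : List α :=
  (List.replicate n l).flatten

@[simp] theorem wordPower_zero (l : List α) : wordPower l 0 = [] := by simp [wordPower]

theorem wordPower_succ (l : List α) (n : ℕ) : wordPower l (n + 1) = l ++ wordPower l n := by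
  simp [wordPower, List.replicate_succ]

@[simp] theorem wordPower_one (l : List α) : wordPower l 1 = l := by simp [wordPower]

theorem wordPower_add (l : List α) (m n : ℕ) :
    wordPower l (m + n) = wordPower l m ++ wordPower l n := by
  rw [wordPower, ← List.replicate_append_replicate, List.flatten_append]
  rfl

theorem wordPower_mul (l : List α) (m n : ℕ) :
    wordPower l (m * n) = wordPower (wordPower l m) n := by
  induction n with
  | zero => simp
  | succ n ih => rw [Nat.mul_succ, Nat.add_comm, wordPower_add, ih, wordPower_succ]

@[simp] theorem length_wordPower (l : List α) (n : ℕ) : (wordPower l n).length = n * l.length := by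
  simp [wordPower]

theorem map_wordPower (f : α → β) (l : List α) (n : ℕ) :
    (wordPower l n).map f = wordPower (l.map f) n := by
  simp [wordPower, List.map_flatten]

theorem wordPower_append_comm (u v : List α) (n : ℕ) :
    wordPower (u ++ v) n ++ u = u ++ wordPower (v ++ u) n := by
  induction n with
  | zero => simp
  | succ n ih => rw [wordPower_succ, List.append_assoc, ih, wordPower_succ]; simp

theorem rotate_one_wordPower (l : List α) (n : ℕ) :
    (wordPower l n).rotate 1 = wordPower (l.rotate 1) n := by
  rcases l with _ | ⟨x, t⟩
  · simp [wordPower]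
  · rcases n with _ | n
    · simp
    · rw [wordPower_succ, List.rotate_cons_succ, List.rotate_zero, wordPower_succ]
      simp only [List.cons_append, List.rotate_cons_succ, List.rotate_zero, List.append_assoc]
      exact congrArg (t ++ ·) (wordPower_append_comm [x] t n)

theorem rotate_wordPower (l : List α) (n r : ℕ) :
    (wordPower l n).rotate r = wordPower (l.rotate r) n := by
  induction r with
  | zero => simp
  | succ r ih => rw [← List.rotate_rotate, ih, rotate_one_wordPower, List.rotate_rotate]

theorem wordPower_left_inj {u v : List α} {n : ℕ} (hn : 0 < n) (hl : u.length = v.length)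
    (h : wordPower u n = wordPower v n) : u = v := by
  obtain ⟨n, rfl⟩ := Nat.exists_eq_succ_of_ne_zero hn.ne'
  rw [Nat.succ_eq_add_one, wordPower_succ, wordPower_succ] at h
  exact (List.append_inj h hl).1

/-- Both `u` and `v` are prefixes of the same word, so `v` begins with `u`; the remainder still
commutes with `u`, and induction applies. -/
theorem eq_power_of_append_comm {u v : List α} {n : ℕ} (hl : v.length = n * u.length)
    (h : v ++ u = u ++ v) : v = wordPower u n := by
  induction n generalizing v with
  | zero => simpa using hl
  | succ n ih =>
    have hpre : u <+: v := by
      refine List.prefix_of_prefix_length_le (l₃ := v ++ u) ⟨v, h.symm⟩ ⟨u, rfl⟩ ?_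
      rw [hl]; exact Nat.le_mul_of_pos_left _ n.succ_pos
    obtain ⟨w, rfl⟩ := hpre
    rw [wordPower_succ, ← ih]
    · rw [List.length_append, Nat.succ_mul] at hl
      omega
    · rw [List.append_assoc] at h
      exact List.append_cancel_left h

theorem eq_power_take_of_rotate_eq {l : List α} {g n : ℕ} (hl : l.length = n * g)
    (h : l.rotate g = l) : l = wordPower (l.take g) n := by
  rcases n with _ | n
  · simpa using hl
  have hg : g ≤ l.length := by rw [hl]; exact Nat.le_mul_of_pos_left _ n.succ_pos
  have hlen : (l.take g).length = g := by simp [hg]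
  have h2 : l.drop g = wordPower (l.take g) n := by
    apply eq_power_of_append_comm
    · rw [hlen, List.length_drop, hl, Nat.succ_mul]
      omega
    · rw [List.rotate_eq_drop_append_take hg] at h
      rw [h, List.take_append_drop]
  rw [wordPower_succ, ← h2, List.take_append_drop]

/-- A nonempty word that is not a proper wordPower. -/
def Primitive (l : List α) : Prop :=
  l ≠ [] ∧ ∀ (d : List α) (n : ℕ), l = wordPower d n → n = 1

/-- The rotation amounts fixing `l` are closed under gcd. Rotation by `gcd r l.length` therefore
fixes `l` and exhibits it as a power of a prefix of that length, which primitivity forces to be all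
of `l`. -/
theorem Primitive.length_dvd_of_rotate_eq {l : List α} (hl : Primitive l) {r : ℕ}
    (h : l.rotate r = l) : l.length ∣ r := by
  have hit : ∀ k, (fun w : List α => w.rotate 1)^[k] l = l.rotate k := fun k => by
    induction k with
    | zero => simp
    | succ k ih => rw [Function.iterate_succ_apply', ih, List.rotate_rotate]
  have h1 : Function.IsPeriodicPt (fun w : List α => w.rotate 1) r l := (hit r).trans h
  have h2 : Function.IsPeriodicPt (fun w : List α => w.rotate 1) l.length l :=
    (hit _).trans l.rotate_length
  have h3 : l.rotate (r.gcd l.length) = l := (hit _).symm.trans (h1.gcd h2)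
  obtain ⟨n, hn⟩ := Nat.gcd_dvd_right r l.length
  rw [mul_comm] at hn
  have h4 := hl.2 _ _ (eq_power_take_of_rotate_eq hn h3)
  rw [h4, one_mul] at hn
  rw [hn]
  exact Nat.gcd_dvd_left _ _

theorem Primitive.length_dvd_of_rotate_power_eq {l : List α} (hl : Primitive l) {n r : ℕ}
    (hn : 0 < n) (h : (wordPower l n).rotate r = wordPower l n) : l.length ∣ r :=
  hl.length_dvd_of_rotate_eq (wordPower_left_inj hn (by simp)
    ((rotate_wordPower l n r).symm.trans h))

/-- Rotation by `d.length` fixes `d ^ k = l ^ n`, so `l.length` divides `d.length`; then initial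
segments are compared. -/
theorem Primitive.exists_eq_power {l d : List α} (hl : Primitive l) {n k : ℕ} (hn : 0 < n)
    (hk : 0 < k) (h : wordPower l n = wordPower d k) : ∃ i, d = wordPower l i ∧ i * k = n := by
  obtain ⟨i, hi⟩ : l.length ∣ d.length := by
    apply hl.length_dvd_of_rotate_power_eq hn
    rw [h, rotate_wordPower, List.rotate_length]
  have hlen := congrArg List.length h
  have hpos : 0 < l.length := List.length_pos_iff.2 hl.1
  rw [length_wordPower, length_wordPower, hi, mul_comm l.length, ← mul_assoc] at hlen
  have hik : n = k * i := Nat.eq_of_mul_eq_mul_right hpos hlen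
  refine ⟨i, ?_, by rw [hik, mul_comm]⟩
  rw [hik, mul_comm, wordPower_mul] at h
  exact (wordPower_left_inj hk (by rw [length_wordPower, hi, mul_comm]) h).symm

theorem Primitive.eq_of_power_eq {l d : List α} (hl : Primitive l) (hd : Primitive d) {n k : ℕ}
    (hn : 0 < n) (hk : 0 < k) (h : wordPower l n = wordPower d k) : l = d := by
  obtain ⟨i, hi, -⟩ := hl.exists_eq_power hn hk h
  rw [hi, hd.2 _ _ hi, wordPower_one]

theorem Primitive.rotate {l : List α} (hl : Primitive l) (r : ℕ) : Primitive (l.rotate r) := by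
  refine ⟨by simpa using hl.1, fun d n h => ?_⟩
  obtain ⟨s, hs⟩ : l.rotate r ~r l := (List.IsRotated.forall l r)
  refine hl.2 (d.rotate s) n ?_
  rw [← rotate_wordPower, ← h, hs]

theorem exists_primitive_power {l : List α} (hl : l ≠ []) :
    ∃ (d : List α) (n : ℕ), Primitive d ∧ 0 < n ∧ l = wordPower d n := by
  induction hk : l.length using Nat.strong_induction_on generalizing l with
  | h k ih =>
    by_cases hp : Primitive l
    · exact ⟨l, 1, hp, one_pos, (wordPower_one l).symm⟩
    · obtain ⟨d, n, h, hn⟩ : ∃ (d : List α) (n : ℕ), l = wordPower d n ∧ n ≠ 1 := by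
        by_contra! hcon
        exact hp ⟨hl, hcon⟩
      have hn0 : n ≠ 0 := by rintro rfl; exact hl (by simpa using h)
      have hd : d ≠ [] := by rintro rfl; exact hl (by simpa [wordPower] using h)
      have hlt : d.length < k := by
        have := List.length_pos_iff.2 hd
        rw [← hk, h, length_wordPower]
        nlinarith [show 2 ≤ n by omega]
      obtain ⟨c, m, hc, hm, rfl⟩ := ih _ hlt hd rfl
      exact ⟨c, m * n, hc, Nat.mul_pos hm (Nat.pos_of_ne_zero hn0), by rw [h, wordPower_mul]⟩

end Words

/-! ### Walks in a digraph. -/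

section Walks

variable {α β : Type*}

/-- The word `l` is the list of vertices, after the first, of a walk from `a` to `b` in the digraph
with arrows `R`. -/
def Walk (R : α → α → Prop) : α → List α → α → Prop
  | a, [], b => a = b
  | a, x :: l, b => R a x ∧ Walk R x l b

theorem walk_append {R : α → α → Prop} {a c : α} {u v : List α} :
    Walk R a (u ++ v) c ↔ ∃ b, Walk R a u b ∧ Walk R b v c := by
  induction u generalizing a with
  | nil => simp [Walk]
  | cons x u ih => simp [Walk, ih, and_assoc]

theorem Walk.unique_end {R : α → α → Prop} {a b b' : α} {u : List α} (h : Walk R a u b)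
    (h' : Walk R a u b') : b = b' := by
  induction u generalizing a with
  | nil => exact h.symm.trans h'
  | cons x u ih => exact ih h.2 h'.2

theorem Walk.power {R : α → α → Prop} {a : α} {l : List α} (h : Walk R a l a) (n : ℕ) :
    Walk R a (wordPower l n) a := by
  induction n with
  | zero => exact rfl
  | succ n ih => rw [wordPower_succ]; exact walk_append.2 ⟨a, h, ih⟩

/-- The end of a walk depends only on its nonempty word. -/
theorem Walk.end_eq {R : α → α → Prop} {a a' b b' : α} {l : List α} (hl : l ≠ [])
    (h : Walk R a l b) (h' : Walk R a' l b') : b = b' := by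
  rcases l with _ | ⟨x, l⟩
  · exact absurd rfl hl
  · exact h.2.unique_end h'.2

/-- The first and the last copy of `l` end at the same vertex, since the end is read off from the
word; the first starts at `a` and the last ends there. -/
theorem Walk.of_power {R : α → α → Prop} {a : α} {l : List α} {n : ℕ} (hl : l ≠ []) (hn : 0 < n)
    (h : Walk R a (wordPower l n) a) : Walk R a l a := by
  obtain ⟨n, rfl⟩ := Nat.exists_eq_succ_of_ne_zero hn.ne'
  have h1 := h
  rw [Nat.succ_eq_add_one, wordPower_succ] at h
  rw [Nat.succ_eq_add_one, wordPower_add, wordPower_one] at h1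
  obtain ⟨b, hb, -⟩ := walk_append.1 h
  obtain ⟨c, -, hc⟩ := walk_append.1 h1
  rw [hb.end_eq hl hc] at hb
  exact hb

theorem Walk.rotate {R : α → α → Prop} {a : α} {l : List α} (h : Walk R a l a) (r : ℕ) :
    ∃ b, Walk R b (l.rotate r) b := by
  induction r with
  | zero => exact ⟨a, by simpa using h⟩
  | succ r ih =>
    obtain ⟨b, hb⟩ := ih
    rw [← List.rotate_rotate]
    generalize l.rotate r = w at hb ⊢
    rcases w with _ | ⟨x, t⟩
    · exact ⟨b, by simpa using hb⟩
    · exact ⟨x, by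
        rw [List.rotate_cons_succ, List.rotate_zero]
        exact walk_append.2 ⟨b, hb.2, hb.1, rfl⟩⟩

/-- A prime word: the list of vertices of a closed walk that is not a proper wordPower. -/
def PrimeWord (R : α → α → Prop) (l : List α) : Prop :=
  (∃ a, Walk R a l a) ∧ Primitive l

theorem PrimeWord.rotate {R : α → α → Prop} {l : List α} (h : PrimeWord R l) (r : ℕ) :
    PrimeWord R (l.rotate r) := by
  obtain ⟨⟨a, ha⟩, hl⟩ := h
  exact ⟨ha.rotate r, hl.rotate r⟩

end Walks

end MultiHypergraph

namespace MultiHypergraph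

/-! ### Coverings of digraphs, monodromy and lifts of prime words. -/

section Covering

variable {α β : Type*} (G : Type*) [Group G] [MulAction G α]

/-- `p : α → β` is a covering of digraphs with arrows `R` and `S` on which the group `G` acts
freely with quotient `β`. The set `F` contains the vertices of `α` that occur in walks. -/
structure IsWalkCovering (R : α → α → Prop) (S : β → β → Prop) (p : α → β) (F : Set α) :
    Prop where
  smul_rel : ∀ (g : G) (a b : α), R a b → R (g • a) (g • b)
  free : ∀ (g : G) (a : α), g • a = a → g = 1
  map_smul : ∀ (g : G) (a : α), p (g • a) = p a
  map_rel : ∀ a b, R a b → S (p a) (p b)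
  mem_of_rel : ∀ a b, R a b → b ∈ F
  exists_smul : ∀ a ∈ F, ∀ b ∈ F, p a = p b → ∃ g : G, g • a = b
  lift : ∀ a ∈ F, ∀ c, S (p a) c → ∃ b, R a b ∧ p b = c
  unique : ∀ (a b : α) (g : G), R a b → R a (g • b) → g = 1
  exists_mem : ∀ b c, S b c → ∃ a ∈ F, p a = c

/-- `g` is a monodromy of the closed walk `l`: the end of the lift of `l` with some initial vertex
`a` is `g • a`. -/
def IsMonodromy (R : α → α → Prop) (p : α → β) (l : List β) (g : G) : Prop :=
  ∃ a m, m.map p = l ∧ Walk R a m (g • a)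

variable {G} {R : α → α → Prop} {S : β → β → Prop} {p : α → β} {F : Set α}

namespace IsWalkCovering

theorem walk_map (h : IsWalkCovering G R S p F) {a b : α} {m : List α} (hm : Walk R a m b) :
    Walk S (p a) (m.map p) (p b) := by
  induction m generalizing a with
  | nil => exact congrArg p hm
  | cons x m ih => exact ⟨h.map_rel _ _ hm.1, ih hm.2⟩

theorem walk_smul (h : IsWalkCovering G R S p F) (g : G) {a b : α} {m : List α}
    (hm : Walk R a m b) : Walk R (g • a) (m.map (g • ·)) (g • b) := by
  induction m generalizing a with
  | nil => exact congrArg (g • ·) hm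
  | cons x m ih => exact ⟨h.smul_rel g _ _ hm.1, ih hm.2⟩

theorem map_map_smul (h : IsWalkCovering G R S p F) (g : G) (m : List α) :
    (m.map (g • ·)).map p = m.map p := by
  simp [Function.comp_def, h.map_smul]

theorem walk_lift (h : IsWalkCovering G R S p F) {a : α} (ha : a ∈ F) {l : List β} {c : β}
    (hl : Walk S (p a) l c) : ∃ m b, m.map p = l ∧ Walk R a m b := by
  induction l generalizing a with
  | nil => exact ⟨[], a, rfl, rfl⟩
  | cons y l ih =>
    obtain ⟨x, hx, rfl⟩ := h.lift a ha y hl.1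
    obtain ⟨m, b, hm, hb⟩ := ih (h.mem_of_rel _ _ hx) hl.2
    exact ⟨x :: m, b, by rw [List.map_cons, hm], hx, hb⟩

theorem walk_unique (h : IsWalkCovering G R S p F) {a b b' : α} {m m' : List α}
    (hm : Walk R a m b) (hm' : Walk R a m' b') (hp : m.map p = m'.map p) : m = m' := by
  induction m generalizing a m' with
  | nil => simpa using hp.symm
  | cons x m ih =>
    rcases m' with _ | ⟨x', m'⟩
    · simp at hp
    · rw [List.map_cons, List.map_cons, List.cons.injEq] at hp
      obtain ⟨g, rfl⟩ := h.exists_smul x (h.mem_of_rel _ _ hm.1) x' (h.mem_of_rel _ _ hm'.1) hp.1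
      obtain rfl := h.unique a x g hm.1 hm'.1
      rw [one_smul] at hm' ⊢
      rw [ih hm.2 hm'.2 hp.2]

theorem walk_end_mem (h : IsWalkCovering G R S p F) {a b : α} {m : List α} (hm : Walk R a m b)
    (hne : m ≠ []) : b ∈ F := by
  induction m generalizing a with
  | nil => exact absurd rfl hne
  | cons x m ih =>
    rcases m with _ | ⟨y, m⟩
    · obtain ⟨h1, rfl⟩ := hm
      exact h.mem_of_rel _ _ h1
    · exact ih hm.2 (by simp)

theorem exists_isMonodromy (h : IsWalkCovering G R S p F) {l : List β} (hne : l ≠ [])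
    (hl : ∃ b, Walk S b l b) : ∃ g : G, IsMonodromy G R p l g := by
  obtain ⟨b, hb⟩ := hl
  -- The base vertex of a nonempty closed walk is its last letter, hence the head of an arrow, and
  -- so has a preimage in `F`.
  obtain ⟨a, ha, rfl⟩ : ∃ a ∈ F, p a = b := by
    rcases List.eq_nil_or_concat l with rfl | ⟨t, y, rfl⟩
    · exact absurd rfl hne
    · rw [List.concat_eq_append] at hb
      obtain ⟨c, -, hc, rfl⟩ := walk_append.1 hb
      exact h.exists_mem _ _ hc
  obtain ⟨m, c, rfl, hm⟩ := h.walk_lift ha hb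
  obtain ⟨g, rfl⟩ := h.exists_smul a ha c (h.walk_end_mem hm (by simpa using hne))
    (hb.unique_end (h.walk_map hm))
  exact ⟨g, a, m, rfl, hm⟩

/-- Monodromies of closed walks that agree up to the initial vertex are conjugate. -/
theorem isConj_of_isMonodromy (h : IsWalkCovering G R S p F) {l : List β} (hne : l ≠ [])
    {g g' : G} (hg : IsMonodromy G R p l g) (hg' : IsMonodromy G R p l g') : IsConj g g' := by
  obtain ⟨a, m, rfl, hm⟩ := hg
  obtain ⟨a', m', hp, hm'⟩ := hg'
  have hne' : m ≠ [] := by simpa using hne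
  have hne2 : m' ≠ [] := by rintro rfl; simp at hp; exact hne' hp
  have hpe : p a = p a' := by
    have h1 := h.walk_map hm
    have h2 := h.walk_map hm'
    rw [hp] at h2
    rw [h.map_smul] at h1 h2
    exact h1.end_eq hne h2
  obtain ⟨k, hk⟩ := h.exists_smul (g • a) (h.walk_end_mem hm hne') (g' • a')
    (h.walk_end_mem hm' hne2) (by rw [h.map_smul, h.map_smul, hpe])
  have ha' : a' = (g'⁻¹ * k * g) • a := by rw [mul_smul, mul_smul, hk, inv_smul_smul]
  -- Translation by `c` takes the first lift to the second, by uniqueness of lifts. Comparing ends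
  -- gives `(c * g) • a = (g' * c) • a`, and freeness gives `c * g = g' * c`.
  set c := g'⁻¹ * k * g with hc
  have h3 := h.walk_smul c hm
  rw [← ha'] at h3
  have h4 := h.walk_unique h3 hm' (by rw [h.map_map_smul, hp])
  rw [h4] at h3
  have h5 := h3.unique_end hm'
  rw [ha', smul_smul, smul_smul] at h5
  have h6 : c * g = g' * c := by
    have := h.free ((g' * c)⁻¹ * (c * g)) a (by rw [mul_smul, h5, inv_smul_smul])
    exact (inv_mul_eq_one.1 this).symm
  rw [isConj_iff]
  exact ⟨c, by rw [h6, mul_inv_cancel_right]⟩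

/-- If the lift from `a` to `g • a` begins with `x`, dropping `x` and appending `g • x` gives a lift
of the rotated word from `x` to `g • x`. -/
theorem isMonodromy_rotate (h : IsWalkCovering G R S p F) {l : List β} {g : G}
    (hg : IsMonodromy G R p l g) (r : ℕ) : IsMonodromy G R p (l.rotate r) g := by
  induction r with
  | zero => simpa using hg
  | succ r ih =>
    obtain ⟨a, m, hp, hm⟩ := ih
    rw [← List.rotate_rotate, ← hp, ← List.map_rotate]
    rcases m with _ | ⟨x, m⟩
    · exact ⟨a, [], by simp, hm⟩
    · refine ⟨x, m ++ [g • x], ?_, walk_append.2 ⟨g • a, hm.2, h.smul_rel g _ _ hm.1, rfl⟩⟩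
      rw [List.rotate_cons_succ, List.rotate_zero, List.map_append, List.map_append]
      simp [h.map_smul]

/-- The lift of the power is the concatenation of `m`, `g • m`, `g ^ 2 • m`, and so on. -/
theorem exists_walk_power (h : IsWalkCovering G R S p F) {a : α} {m : List α} {g : G}
    (hm : Walk R a m (g • a)) (n : ℕ) :
    ∃ M : List α, M.map p = wordPower (m.map p) n ∧ Walk R a M (g ^ n • a) := by
  induction n with
  | zero => exact ⟨[], by simp, by simp [Walk]⟩
  | succ n ih =>
    obtain ⟨M, hM, hw⟩ := ih
    refine ⟨m ++ M.map (g • ·), ?_, walk_append.2 ⟨_, hm, ?_⟩⟩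
    · rw [List.map_append, h.map_map_smul, hM, wordPower_succ]
    · have := h.walk_smul g hw
      rwa [smul_smul, ← pow_succ'] at this

end IsWalkCovering

/-- The data of a prime word of the base of a covering, its lift and the lift of the power that
lifts to a closed walk. -/
structure PrimeLift (R : α → α → Prop) (S : β → β → Prop) (p : α → β) (l : List β) (g : G)
    (a : α) (m M : List α) : Prop where
  prime : PrimeWord S l
  map_lift : m.map p = l
  walk_lift : Walk R a m (g • a)
  map_power : M.map p = wordPower l (orderOf g)
  walk_power : Walk R a M a
  orderOf_pos : 0 < orderOf g

theorem IsWalkCovering.exists_primeLift [Finite G] (h : IsWalkCovering G R S p F) {l : List β}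
    (hl : PrimeWord S l) : ∃ (g : G) (a : α) (m M : List α), PrimeLift R S p l g a m M := by
  obtain ⟨g, a, m, hm, hw⟩ := h.exists_isMonodromy hl.2.1 hl.1
  obtain ⟨M, hM, hW⟩ := h.exists_walk_power hw (orderOf g)
  rw [pow_orderOf_eq_one, one_smul] at hW
  exact ⟨g, a, m, M, hl, hm, hw, by rw [hM, hm], hW, orderOf_pos g⟩

namespace PrimeLift

variable {l : List β} {g : G} {a : α} {m M : List α}

theorem isMonodromy (d : PrimeLift R S p l g a m M) : IsMonodromy G R p l g :=
  ⟨a, m, d.map_lift, d.walk_lift⟩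

theorem length_eq (d : PrimeLift R S p l g a m M) : M.length = orderOf g * l.length := by
  have := congrArg List.length d.map_power
  simpa using this

theorem ne_nil (d : PrimeLift R S p l g a m M) : M ≠ [] := by
  rintro rfl
  have := d.length_eq
  have h1 := List.length_pos_iff.2 d.prime.2.1
  have h2 := d.orderOf_pos
  rw [List.length_nil] at this
  exact (Nat.mul_pos h2 h1).ne this

/-- The end of the lift of a power of the prime word that starts at a translate of `a`. -/
theorem end_eq (h : IsWalkCovering G R S p F) (d : PrimeLift R S p l g a m M) {k : G} {b : α}
    {w : List α} {n : ℕ} (hw : Walk R (k • a) w b) (hp : w.map p = wordPower l n) :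
    b = (k * g ^ n) • a := by
  obtain ⟨N, hN, hN2⟩ := h.exists_walk_power d.walk_lift n
  have h1 := h.walk_smul k hN2
  have h2 := h.walk_unique h1 hw (by rw [h.map_map_smul, hN, hp, d.map_lift])
  rw [h2] at h1
  rw [hw.unique_end h1, mul_smul]

theorem orderOf_dvd (h : IsWalkCovering G R S p F) (d : PrimeLift R S p l g a m M) {k : G}
    {w : List α} {n : ℕ} (hw : Walk R (k • a) w (k • a)) (hp : w.map p = wordPower l n) :
    orderOf g ∣ n := by
  have h1 := d.end_eq h hw hp
  apply orderOf_dvd_of_pow_eq_one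
  apply h.free _ a
  rw [mul_smul] at h1
  exact (smul_left_cancel k h1).symm

/-- If the lift were `c ^ n`, then `c` would be closed and lie over some `l ^ i` with `i * n =
orderOf g`. Closedness makes `orderOf g` divide `i`, so `n = 1`. -/
theorem primeWord_smul (h : IsWalkCovering G R S p F) (d : PrimeLift R S p l g a m M) (k : G) :
    PrimeWord R (M.map (k • ·)) := by
  have hw := h.walk_smul k d.walk_power
  refine ⟨⟨_, hw⟩, by simpa using d.ne_nil, fun c n hc => ?_⟩
  have hn : 0 < n := by
    rcases Nat.eq_zero_or_pos n with rfl | hn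
    · simp [d.ne_nil] at hc
    · exact hn
  have hcne : c ≠ [] := by
    rintro rfl
    simp [wordPower, d.ne_nil] at hc
  have h1 := congrArg (List.map p) hc
  rw [h.map_map_smul, d.map_power, map_wordPower] at h1
  obtain ⟨i, hi, hin⟩ := d.prime.2.exists_eq_power d.orderOf_pos hn h1
  rw [hc] at hw
  obtain ⟨j, hj⟩ := d.orderOf_dvd h (hw.of_power hcne hn) hi
  rw [hj, mul_assoc] at hin
  have := d.orderOf_pos
  have h2 : j * n = 1 := by
    apply Nat.eq_of_mul_eq_mul_left this
    rw [hin, mul_one]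
  exact Nat.eq_one_of_mul_eq_one_left h2

/-- One turn around `l` moves the start of the lift from `k • a` to `(k * g) • a`. Multiplication by
`g` is on the right, which is why left cosets of `⟨g⟩` appear. -/
theorem rotate_length (h : IsWalkCovering G R S p F) (d : PrimeLift R S p l g a m M) (k : G) :
    (M.map (k • ·)).rotate l.length = M.map ((k * g) • ·) := by
  obtain ⟨f, hf⟩ := Nat.exists_eq_succ_of_ne_zero d.orderOf_pos.ne'
  have hp := d.map_power
  rw [hf, Nat.succ_eq_add_one, wordPower_succ] at hp
  obtain ⟨u, v, rfl, hu, hv⟩ := List.map_eq_append_iff.1 hp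
  have hw := h.walk_smul k d.walk_power
  rw [List.map_append] at hw
  obtain ⟨b, hb, hb2⟩ := walk_append.1 hw
  have hbe : b = (k * g) • a := by
    have := d.end_eq h hb (n := 1) (by rw [h.map_map_smul, hu, wordPower_one])
    rwa [pow_one] at this
  rw [List.map_append, ← hu, List.length_map, ← List.length_map (f := (k • ·)),
    List.rotate_append_length_eq]
  subst hbe
  refine h.walk_unique (walk_append.2 ⟨_, hb2, hb⟩) (h.walk_smul (k * g) d.walk_power) ?_
  rw [h.map_map_smul, List.map_append, h.map_map_smul, h.map_map_smul, hu, hv, d.map_power, hf,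
    Nat.succ_eq_add_one, wordPower_add, wordPower_one]

theorem rotate_length_mul (h : IsWalkCovering G R S p F) (d : PrimeLift R S p l g a m M) (k : G)
    (s : ℕ) : (M.map (k • ·)).rotate (l.length * s) = M.map ((k * g ^ s) • ·) := by
  induction s with
  | zero => simp
  | succ s ih =>
    rw [Nat.mul_succ, ← List.rotate_rotate, ih, d.rotate_length h, pow_succ, mul_assoc]

/-- A rotation relating two translates fixes the projected power of `l`, so by primitivity it
consists of `s` whole turns, and these replace `k` by `k * g ^ s`. -/
theorem isRotated_iff [Finite G] (h : IsWalkCovering G R S p F) (d : PrimeLift R S p l g a m M)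
    (k k' : G) : M.map (k • ·) ~r M.map (k' • ·) ↔
      (k : G ⧸ Subgroup.zpowers g) = (k' : G ⧸ Subgroup.zpowers g) := by
  rw [QuotientGroup.eq]
  constructor
  · rintro ⟨r, hr⟩
    have h1 := congrArg (List.map p) hr
    rw [List.map_rotate, h.map_map_smul, h.map_map_smul, d.map_power] at h1
    obtain ⟨s, rfl⟩ := d.prime.2.length_dvd_of_rotate_power_eq d.orderOf_pos h1
    rw [d.rotate_length_mul h] at hr
    obtain ⟨x, t, hx⟩ := List.exists_cons_of_ne_nil d.ne_nil
    rw [hx, List.map_cons, List.map_cons, List.cons.injEq] at hr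
    have h2 : k * g ^ s = k' := by
      have := h.free (k'⁻¹ * (k * g ^ s)) x (by rw [mul_smul, hr.1, inv_smul_smul])
      exact (inv_mul_eq_one.1 this).symm
    rw [← h2, inv_mul_cancel_left]
    exact Subgroup.npow_mem_zpowers g s
  · intro hk
    rw [← (isOfFinOrder_of_finite g).mem_powers_iff_mem_zpowers] at hk
    obtain ⟨s, hs⟩ := hk
    have h2 : k * g ^ s = k' := by
      rw [show g ^ s = k⁻¹ * k' from hs, mul_inv_cancel_left]
    exact ⟨_, by rw [d.rotate_length_mul h, h2]⟩

theorem isRotated_base (h : IsWalkCovering G R S p F) (d : PrimeLift R S p l g a m M)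
    {l' : List β} {g' : G} {a' : α} {m' M' : List α} (d' : PrimeLift R S p l' g' a' m' M')
    {k k' : G} (hr : M.map (k • ·) ~r M'.map (k' • ·)) : l ~r l' := by
  obtain ⟨r, hr⟩ := hr
  have h1 := congrArg (List.map p) hr
  rw [List.map_rotate, h.map_map_smul, h.map_map_smul, d.map_power, d'.map_power,
    rotate_wordPower] at h1
  exact ⟨r, (d.prime.2.rotate r).eq_of_power_eq d'.prime.2 d.orderOf_pos d'.orderOf_pos h1⟩

/-- After rotation `w` is a closed lift of `l ^ n` starting at a translate of `a`. Hence `orderOf g`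
divides `n`, `w` is a power of a translate of `M`, and primitivity makes the exponent `1`. -/
theorem exists_isRotated (h : IsWalkCovering G R S p F) (d : PrimeLift R S p l g a m M)
    {w : List α} (hw : PrimeWord R w) {n : ℕ} (hn : 0 < n) {c : List β}
    (hc : w.map p = wordPower c n) (hcl : c ~r l) : ∃ k : G, M.map (k • ·) ~r w := by
  obtain ⟨r, hr⟩ := hcl
  obtain ⟨⟨b, hb⟩, hprim⟩ := hw.rotate r
  have hp : (w.rotate r).map p = wordPower l n := by
    rw [List.map_rotate, hc, rotate_wordPower, hr]
  have hlne : wordPower l n ≠ [] := by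
    rw [← List.length_pos_iff, length_wordPower]
    exact Nat.mul_pos hn (List.length_pos_iff.2 d.prime.2.1)
  obtain ⟨k, rfl⟩ : ∃ k : G, k • a = b := by
    have ha : a ∈ F := h.walk_end_mem d.walk_power d.ne_nil
    have hbF : b ∈ F := h.walk_end_mem hb hprim.1
    refine h.exists_smul a ha b hbF ?_
    have h1 := h.walk_map hb
    rw [hp] at h1
    have h2 := h1.of_power d.prime.2.1 hn
    have h3 := h.walk_map d.walk_lift
    rw [d.map_lift, h.map_smul] at h3
    exact h3.end_eq d.prime.2.1 h2
  obtain ⟨q, rfl⟩ := d.orderOf_dvd h hb hp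
  refine ⟨k, ?_⟩
  have h4 : w.rotate r = wordPower (M.map (k • ·)) q := by
    refine h.walk_unique hb ((h.walk_smul k d.walk_power).power q) ?_
    rw [hp, map_wordPower, h.map_map_smul, d.map_power, wordPower_mul]
  have h5 := hprim.2 _ _ h4
  rw [h5, wordPower_one] at h4
  rw [← h4]
  exact List.IsRotated.forall w r

end PrimeLift

end Covering

end MultiHypergraph

namespace MultiHypergraph

/-! ### Prime cycles as primitive closed walks on flags. -/

section Cycles

variable {V E : Type*} (H : MultiHypergraph V E)

/-- The set of flags: pairs of a hyperedge and an incident vertex. -/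
def flags : Set (E × V) := {x | x.2 ∈ H.verts x.1}

/-- Two flags `(e, v)` and `(f, w)` are joined by an arrow if `v, f, w` can follow `e` in a path
without backtracking. -/
def Arrow (x y : E × V) : Prop :=
  x.2 ∈ H.verts x.1 ∧ x.2 ∈ H.verts y.1 ∧ y.2 ∈ H.verts y.1 ∧ x.1 ≠ y.1 ∧ x.2 ≠ y.2

variable {H}

theorem walk_arrow_iff {x y : E × V} (hx : x ∈ H.flags) {l : List (E × V)} :
    Walk H.Arrow x l y ↔ H.IsPath x.2 l ∧ (x.1 :: l.map Prod.fst).IsChain (· ≠ ·) ∧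
      (x.2 :: l.map Prod.snd).IsChain (· ≠ ·) ∧ l.getLastD x = y := by
  induction l generalizing x with
  | nil => simp [Walk, IsPath]
  | cons z l ih =>
    obtain ⟨e, w⟩ := z
    simp only [Walk, IsPath, List.map_cons, List.isChain_cons_cons, List.getLastD_cons, Arrow]
    constructor
    · rintro ⟨⟨-, h1, h2, h3, h4⟩, h5⟩
      obtain ⟨k1, k2, k3, k4⟩ := (ih h2).1 h5
      exact ⟨⟨h1, h2, k1⟩, ⟨h3, k2⟩, ⟨h4, k3⟩, k4⟩
    · rintro ⟨⟨h1, h2, k1⟩, ⟨h3, k2⟩, ⟨h4, k3⟩, k4⟩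
      exact ⟨⟨hx, h1, h2, h3, h4⟩, (ih h2).2 ⟨k1, k2, k3, k4⟩⟩

theorem terminal_eq_getLastD (x : E × V) (l : List (E × V)) :
    terminal x.2 l = (l.getLastD x).2 := by
  induction l generalizing x with
  | nil => rfl
  | cons z l ih => rw [List.getLastD_cons]; exact ih z

theorem terminal_append (v : V) (l l' : List (E × V)) :
    terminal v (l ++ l') = terminal (terminal v l) l' := by
  induction l generalizing v with
  | nil => rfl
  | cons z l ih => exact ih z.2

theorem Walk.isPath_of_arrow {x y : E × V} {l : List (E × V)} (hx : x ∈ H.flags)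
    (h : Walk H.Arrow x l y) :
    H.IsPath x.2 l ∧ NoBacktracking x.2 l ∧ terminal x.2 l = y.2 := by
  obtain ⟨h1, h2, h3, h4⟩ := (walk_arrow_iff hx).1 h
  refine ⟨h1, ⟨?_, h3⟩, ?_⟩
  · exact h2.tail
  · rw [terminal_eq_getLastD, h4]

theorem Walk.mem_flags_of_arrow {x y : E × V} {l : List (E × V)} (hl : l ≠ [])
    (h : Walk H.Arrow x l y) : x ∈ H.flags := by
  rcases l with _ | ⟨z, l⟩
  · exact absurd rfl hl
  · exact h.1.1

theorem Walk.isCycle_of_arrow {x : E × V} {l : List (E × V)} (hl : l ≠ [])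
    (h : Walk H.Arrow x l x) : H.IsCycle x.2 l := by
  obtain ⟨h1, -, h3⟩ := h.isPath_of_arrow (h.mem_flags_of_arrow hl)
  refine ⟨h1, h3, ?_⟩
  -- A closed walk with one letter would be an arrow from a flag to itself, contradicting
  -- distinctness of consecutive hyperedges.
  match l, hl, h with
  | [z], _, h =>
    obtain ⟨h4, rfl⟩ := h
    exact absurd rfl h4.2.2.2.1
  | _ :: _ :: _, _, _ => simp

theorem PrimeWord.isPrimeCycle {l : List (E × V)} (h : PrimeWord H.Arrow l) :
    ∃ v, H.IsPrimeCycle v l := by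
  obtain ⟨⟨x, hx⟩, hl⟩ := h
  have hF := hx.mem_flags_of_arrow hl.1
  refine ⟨x.2, hx.isCycle_of_arrow hl.1, (hx.isPath_of_arrow hF).2.1,
    ((hx.power 2).isPath_of_arrow hF).2.1, fun d n hn _ hd => ?_⟩
  have := hl.2 d n hd
  omega

theorem IsPath.mem_flags_of_append {v : V} {t : List (E × V)} {y : E × V}
    (h : H.IsPath v (t ++ [y])) : y ∈ H.flags := by
  induction t generalizing v with
  | nil => exact h.2.1
  | cons s t ih => exact ih h.2.2

theorem IsPrimeCycle.exists_walk {v : V} {l : List (E × V)} (h : H.IsPrimeCycle v l) :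
    ∃ e, Walk H.Arrow (e, v) l (e, v) := by
  obtain ⟨⟨hpath, hterm, hlen⟩, hnb, hnb2, hprim⟩ := h
  have hne : l ≠ [] := by rintro rfl; simp at hlen
  obtain ⟨t, y, rfl⟩ : ∃ t y, l = t ++ [y] := by
    rcases List.eq_nil_or_concat l with h0 | ⟨t, y, h0⟩
    · exact absurd h0 hne
    · exact ⟨t, y, by rw [h0, List.concat_eq_append]⟩
  obtain rfl : y.2 = v := by
    rw [terminal_append] at hterm
    exact hterm
  -- The starting flag records the hyperedge before the first one, which cyclically is the last.
  -- That it differs from the first is the absence of a tail, read off below from a suffix of the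
  -- square.
  refine ⟨y.1, ?_⟩
  have hyF : y ∈ H.flags := hpath.mem_flags_of_append
  refine (walk_arrow_iff hyF).2 ⟨hpath, ?_, hnb.2, by simp⟩
  have h1 := hnb2.1
  rw [show power (t ++ [y]) 2 = t ++ ([y] ++ (t ++ [y])) by simp [power, List.replicate_succ],
    List.map_append] at h1
  simpa using h1.right_of_append

/-- Primeness excludes only powers of cycles, primitivity powers of any word; the two agree because
a root of a closed walk is again a closed walk, hence a cycle. -/
theorem IsPrimeCycle.primeWord {v : V} {l : List (E × V)} (h : H.IsPrimeCycle v l) :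
    PrimeWord H.Arrow l := by
  obtain ⟨e, he⟩ := h.exists_walk
  have hne : l ≠ [] := by rintro rfl; simp [IsPrimeCycle, IsCycle] at h
  refine ⟨⟨_, he⟩, hne, fun d n hd => ?_⟩
  have hn : 0 < n := by
    rcases Nat.eq_zero_or_pos n with rfl | hn
    · simp [hne] at hd
    · exact hn
  have hdne : d ≠ [] := by
    rintro rfl
    simp [wordPower, hne] at hd
  by_contra hn1
  rw [hd] at he
  exact h.2.2.2 d n (by omega) ((he.of_power hdne hn).isCycle_of_arrow hdne) hd

end Cycles

/-! ### Free Galois coverings as coverings of flag digraphs. -/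

section Galois

variable {VY EY VX EX G : Type*} [Group G] [MulAction G VY] [MulAction G EY]
  {Y : MultiHypergraph VY EY} {X : MultiHypergraph VX EX} {π : Y.Hom X}

namespace IsFreeAction

theorem eq_one_of_mem (h : Y.IsFreeAction G) {v : VY} {e : EY} {g : G} (h1 : v ∈ Y.verts e)
    (h2 : g • v ∈ Y.verts e) : g = 1 := by
  by_contra hg
  exact h.smul_notMem v e h1 g hg h2

theorem eq_one_of_mem_smul (h : Y.IsFreeAction G) {v : VY} {e : EY} {g : G} (h1 : v ∈ Y.verts e)
    (h2 : v ∈ Y.verts (g • e)) : g = 1 := by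
  have h3 : g⁻¹ • v ∈ Y.verts e := by rwa [← h.isAction g, smul_inv_smul]
  exact inv_eq_one.1 (h.eq_one_of_mem h1 h3)

end IsFreeAction

namespace IsFreeGaloisCovering

theorem onV_eq_iff (h : IsFreeGaloisCovering G π) {v w : VY} :
    π.onV v = π.onV w ↔ ∃ g : G, g • v = w := by
  obtain ⟨φ, hV, -⟩ := h.exists_iso_quotient
  rw [← φ.onV.apply_eq_iff_eq, hV, hV, eq_comm]
  exact Quotient.eq''

theorem onE_eq_iff (h : IsFreeGaloisCovering G π) {e f : EY} :
    π.onE e = π.onE f ↔ ∃ g : G, g • e = f := by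
  obtain ⟨φ, -, hE⟩ := h.exists_iso_quotient
  rw [← φ.onE.apply_eq_iff_eq, hE, hE, eq_comm]
  exact Quotient.eq''

theorem onV_smul (h : IsFreeGaloisCovering G π) (g : G) (v : VY) : π.onV (g • v) = π.onV v :=
  (h.onV_eq_iff.2 ⟨g, rfl⟩).symm

theorem onE_smul (h : IsFreeGaloisCovering G π) (g : G) (e : EY) : π.onE (g • e) = π.onE e :=
  (h.onE_eq_iff.2 ⟨g, rfl⟩).symm

theorem exists_flag (h : IsFreeGaloisCovering G π) {a : VX} {b : EX} (hab : a ∈ X.verts b) :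
    ∃ v e, π.onV v = a ∧ π.onE e = b ∧ v ∈ Y.verts e := by
  obtain ⟨φ, hV, hE⟩ := h.exists_iso_quotient
  obtain ⟨v, e, hv, he, hve⟩ := (φ.map_mem_iff a b).2 hab
  exact ⟨v, e, φ.onV.injective ((hV v).trans hv), φ.onE.injective ((hE e).trans he), hve⟩

theorem exists_edge (h : IsFreeGaloisCovering G π) {v : VY} {b : EX} (hb : π.onV v ∈ X.verts b) :
    ∃ e, π.onE e = b ∧ v ∈ Y.verts e := by
  obtain ⟨w, e, hw, rfl, hwe⟩ := h.exists_flag hb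
  obtain ⟨g, rfl⟩ := h.onV_eq_iff.1 hw
  exact ⟨g • e, h.onE_smul g e, (h.isFreeAction.isAction g w e).2 hwe⟩

theorem exists_vertex (h : IsFreeGaloisCovering G π) {e : EY} {a : VX}
    (ha : a ∈ X.verts (π.onE e)) : ∃ v, π.onV v = a ∧ v ∈ Y.verts e := by
  obtain ⟨v, f, rfl, hf, hvf⟩ := h.exists_flag ha
  obtain ⟨g, rfl⟩ := h.onE_eq_iff.1 hf
  exact ⟨g • v, h.onV_smul g v, (h.isFreeAction.isAction g v f).2 hvf⟩

theorem edge_unique (h : IsFreeGaloisCovering G π) {v : VY} {e f : EY} (he : v ∈ Y.verts e)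
    (hf : v ∈ Y.verts f) (hef : π.onE e = π.onE f) : e = f := by
  obtain ⟨g, rfl⟩ := h.onE_eq_iff.1 hef
  rw [h.isFreeAction.eq_one_of_mem_smul he hf, one_smul]

theorem vertex_unique (h : IsFreeGaloisCovering G π) {v w : VY} {e : EY} (hv : v ∈ Y.verts e)
    (hw : w ∈ Y.verts e) (hvw : π.onV v = π.onV w) : v = w := by
  obtain ⟨g, rfl⟩ := h.onV_eq_iff.1 hvw
  rw [h.isFreeAction.eq_one_of_mem hv hw, one_smul]

/-- No hyperedge contains two vertices of one orbit, so `π` is injective on the vertices of a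
hyperedge and on the hyperedges through a vertex. This gives unique lifting and keeps projected
walks free of backtracking. The restriction to `flags` is needed since two non-incident pairs with
equal image need not be `G`-translates. -/
theorem isWalkCovering (h : IsFreeGaloisCovering G π) :
    IsWalkCovering G Y.Arrow X.Arrow (Prod.map π.onE π.onV) Y.flags where
  smul_rel := by
    rintro g ⟨e, v⟩ ⟨f, w⟩ ⟨h1, h2, h3, h4, h5⟩
    have ha := h.isFreeAction.isAction g
    exact ⟨(ha _ _).2 h1, (ha _ _).2 h2, (ha _ _).2 h3,
      fun h6 => h4 (smul_left_cancel g h6), fun h6 => h5 (smul_left_cancel g h6)⟩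
  free g a hg := h.isFreeAction.free_vertices g a.2 (congrArg Prod.snd hg)
  map_smul g a := Prod.ext (h.onE_smul g a.1) (h.onV_smul g a.2)
  map_rel := by
    rintro ⟨e, v⟩ ⟨f, w⟩ ⟨h1, h2, h3, h4, h5⟩
    exact ⟨π.map_mem _ _ h1, π.map_mem _ _ h2, π.map_mem _ _ h3,
      fun h6 => h4 (h.edge_unique h1 h2 h6), fun h6 => h5 (h.vertex_unique h2 h3 h6)⟩
  mem_of_rel a b hab := hab.2.2.1
  exists_smul := by
    rintro ⟨e, v⟩ h1 ⟨f, w⟩ h2 hp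
    obtain ⟨g, rfl⟩ := h.onE_eq_iff.1 (congrArg Prod.fst hp)
    refine ⟨g, Prod.ext rfl ?_⟩
    exact h.vertex_unique ((h.isFreeAction.isAction g v e).2 h1) h2
      ((h.onV_smul g v).trans (congrArg Prod.snd hp))
  lift := by
    rintro ⟨e, v⟩ h1 ⟨f, w⟩ ⟨-, h2, h3, h4, h5⟩
    obtain ⟨f, rfl, hf⟩ := h.exists_edge h2
    obtain ⟨w, rfl, hw⟩ := h.exists_vertex h3
    refine ⟨(f, w), ⟨h1, hf, hw, ?_, ?_⟩, rfl⟩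
    · rintro rfl; exact h4 rfl
    · rintro rfl; exact h5 rfl
  unique := by
    rintro ⟨e, v⟩ ⟨f, w⟩ g ⟨-, h1, -⟩ ⟨-, h2, -⟩
    exact h.isFreeAction.eq_one_of_mem_smul h1 h2
  exists_mem := by
    rintro b ⟨f, w⟩ ⟨-, -, h3, -⟩
    obtain ⟨v, e, h4, h5, h6⟩ := h.exists_flag h3
    exact ⟨(e, v), h6, Prod.ext h5 h4⟩

theorem exists_lift (h : IsFreeGaloisCovering G π) {v : VY} {l : List (EX × VX)}
    (hl : X.IsPath (π.onV v) l) : ∃ m, Y.IsPath v m ∧ π.mapSteps m = l := by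
  induction l generalizing v with
  | nil => exact ⟨[], trivial, rfl⟩
  | cons x l ih =>
    obtain ⟨f, w⟩ := x
    obtain ⟨h1, h2, h3⟩ := hl
    obtain ⟨f, rfl, hf⟩ := h.exists_edge h1
    obtain ⟨w, rfl, hw⟩ := h.exists_vertex h2
    obtain ⟨m, hm, rfl⟩ := ih h3
    exact ⟨(f, w) :: m, ⟨hf, hw, hm⟩, rfl⟩

theorem lift_unique (h : IsFreeGaloisCovering G π) {v : VY} {m m' : List (EY × VY)}
    (hm : Y.IsPath v m) (hm' : Y.IsPath v m') (hp : π.mapSteps m = π.mapSteps m') : m = m' := by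
  induction m generalizing v m' with
  | nil => exact (List.map_eq_nil_iff.1 hp.symm).symm
  | cons x m ih =>
    rcases m' with _ | ⟨y, m'⟩
    · exact absurd hp (by simp [Hom.mapSteps])
    · obtain ⟨e, w⟩ := x
      obtain ⟨e', w'⟩ := y
      obtain ⟨h1, h2, h3⟩ := hm
      obtain ⟨k1, k2, k3⟩ := hm'
      simp only [Hom.mapSteps, List.map_cons, List.cons.injEq, Prod.map_apply, Prod.mk.injEq] at hp
      obtain rfl := h.edge_unique h1 k1 hp.1.1
      obtain rfl := h.vertex_unique h2 k2 hp.1.2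
      rw [ih h3 k3 hp.2]

theorem finite_group (h : IsFreeGaloisCovering G π) : Finite G := by
  have := Y.finite_vertices
  obtain ⟨v⟩ := Y.nonempty_vertices
  refine Finite.of_injective (fun g : G => g • v) fun g k hgk => ?_
  have := h.isFreeAction.free_vertices (k⁻¹ * g) v (by
    rw [mul_smul, show g • v = k • v from hgk, inv_smul_smul])
  exact (inv_mul_eq_one.1 this).symm

end IsFreeGaloisCovering

theorem onV_terminal (π : Y.Hom X) (v : VY) (m : List (EY × VY)) :
    π.onV (terminal v m) = terminal (π.onV v) (π.mapSteps m) := by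
  induction m generalizing v with
  | nil => rfl
  | cons x m ih => exact ih x.2

end Galois

end MultiHypergraph

namespace MultiHypergraph

/-! ### Simple paths in a spanning tree. -/

section Trees

variable {V E : Type*}

/-- The vertices of `V ⊔ E` visited by a path. -/
def walkSupport (v : V) (l : List (E × V)) : List (V ⊕ E) :=
  .inl v :: l.flatMap fun x => [.inr x.1, .inl x.2]

theorem walkSupport_cons (v : V) (x : E × V) (l : List (E × V)) :
    walkSupport v (x :: l) = .inl v :: .inr x.1 :: walkSupport x.2 l := rfl

theorem walkSupport_injective (v : V) : Function.Injective (walkSupport (E := E) v) := by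
  intro l l' h
  induction l generalizing v l' with
  | nil =>
    rcases l' with _ | ⟨y, l'⟩
    · rfl
    · simp [walkSupport] at h
  | cons x l ih =>
    rcases l' with _ | ⟨y, l'⟩
    · simp [walkSupport] at h
    · rw [walkSupport_cons, walkSupport_cons, List.cons.injEq, List.cons.injEq,
        Sum.inr.injEq] at h
      have h2 : x.2 = y.2 := Sum.inl.inj (List.cons.inj h.2.2).1
      rw [← h2] at h
      rw [ih x.2 h.2.2, Prod.ext h.2.1 h2]

theorem walkSupport_perm (v : V) (l : List (E × V)) :
    (walkSupport v l).Perm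
      ((v :: l.map Prod.snd).map Sum.inl ++ (l.map Prod.fst).map Sum.inr) := by
  induction l generalizing v with
  | nil => simp [walkSupport]
  | cons x l ih =>
    rw [walkSupport_cons]
    simp only [List.map_cons, List.cons_append]
    refine List.Perm.cons _ (((ih x.2).cons _).trans ?_)
    simp only [List.map_cons, List.cons_append]
    refine (List.Perm.swap _ _ _).trans (List.Perm.cons _ ?_)
    exact List.perm_middle.symm

theorem nodup_walkSupport_iff {v : V} {l : List (E × V)} :
    (walkSupport v l).Nodup ↔ IsSimple v l := by
  rw [(walkSupport_perm v l).nodup_iff, List.nodup_append',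
    List.nodup_map_iff Sum.inl_injective, List.nodup_map_iff Sum.inr_injective, IsSimple]
  constructor
  · exact fun h => ⟨h.1, h.2.1⟩
  · refine fun h => ⟨h.1, h.2, ?_⟩
    intro x hx hx'
    obtain ⟨a, -, rfl⟩ := List.mem_map.1 hx
    obtain ⟨b, -, hb⟩ := List.mem_map.1 hx'
    exact Sum.inr_ne_inl hb

theorem InGraph.exists_walk {T : SimpleGraph (V ⊕ E)} {v w : V} {l : List (E × V)}
    (h : InGraph T v l) (hw : terminal v l = w) :
    ∃ p : T.Walk (.inl v) (.inl w), p.support = walkSupport v l := by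
  induction l generalizing v with
  | nil =>
    obtain rfl : v = w := hw
    exact ⟨.nil, rfl⟩
  | cons x l ih =>
    obtain ⟨p, hp⟩ := ih h.2.2 hw
    exact ⟨.cons h.1 (.cons h.2.1 p), by
      rw [SimpleGraph.Walk.support_cons, SimpleGraph.Walk.support_cons, hp]; rfl⟩

theorem exists_inGraph {H : MultiHypergraph V E} {T : SimpleGraph (V ⊕ E)}
    (hT : T ≤ H.bipartite) (n : ℕ) : ∀ {v w : V} (p : T.Walk (.inl v) (.inl w)), p.length = n →
      ∃ l, InGraph T v l ∧ terminal v l = w ∧ p.support = walkSupport v l := by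
  induction n using Nat.strong_induction_on with
  | h n ih =>
    intro v w p hp
    rcases p with _ | ⟨h1, q⟩
    · exact ⟨[], trivial, rfl, rfl⟩
    · rename_i x
      rcases x with x | e
      · exact (hT h1).elim
      · rcases q with _ | ⟨h2, q⟩
        rename_i y
        rcases y with u | f
        · obtain ⟨l, hl1, hl2, hl3⟩ := ih q.length (by
            simp only [SimpleGraph.Walk.length_cons] at hp; omega) q rfl
          refine ⟨(e, u) :: l, ⟨h1, h2, hl1⟩, hl2, ?_⟩
          rw [SimpleGraph.Walk.support_cons, SimpleGraph.Walk.support_cons, hl3]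
          rfl
        · exact (hT h2).elim

theorem InGraph.isPath {H : MultiHypergraph V E} {T : SimpleGraph (V ⊕ E)}
    (hT : T ≤ H.bipartite) {v : V} {l : List (E × V)} (h : InGraph T v l) : H.IsPath v l := by
  induction l generalizing v with
  | nil => trivial
  | cons x l ih => exact ⟨hT h.1, hT h.2.1, ih h.2.2⟩

/-- In a spanning tree there is exactly one simple path between two vertices. -/
theorem existsUnique_simple_inGraph {H : MultiHypergraph V E} {T : SimpleGraph (V ⊕ E)}
    (hT : T ≤ H.bipartite) (hTree : T.IsTree) (v w : V) :
    ∃! l, InGraph T v l ∧ IsSimple v l ∧ terminal v l = w := by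
  classical
  obtain ⟨q⟩ := hTree.connected.preconnected (.inl v) (.inl w)
  obtain ⟨l, h1, h2, h3⟩ := exists_inGraph hT _ q.bypass rfl
  refine ⟨l, ⟨h1, nodup_walkSupport_iff.1 (h3 ▸ q.bypass_isPath.support_nodup), h2⟩, ?_⟩
  rintro l' ⟨k1, k2, k3⟩
  obtain ⟨p, hp⟩ := k1.exists_walk k3
  have hpath : p.IsPath := by
    rw [SimpleGraph.Walk.isPath_def, hp]
    exact nodup_walkSupport_iff.2 k2
  have h4 := (hTree.isAcyclic.subsingleton_path _ _).elim ⟨p, hpath⟩ ⟨q.bypass, q.bypass_isPath⟩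
  rw [Subtype.mk.injEq] at h4
  apply walkSupport_injective v
  rw [← hp, ← h3, h4]

end Trees

/-! ### Sheets and Frobenius elements. -/

section Frobenius

variable {VY EY VX EX G : Type*} [Group G] [MulAction G VY] [MulAction G EY]
  {Y : MultiHypergraph VY EY} {X : MultiHypergraph VX EX} {π : Y.Hom X}

namespace Choices

/-- The tree contains one simple path from the base to `v`, and that path has one lift from the
chosen point. -/
theorem existsUnique_mem_identitySheet (h : IsFreeGaloisCovering G π) (S : Choices π) (v : VX) :
    ∃! s, s ∈ S.identitySheet ∧ π.onV s = v := by
  obtain ⟨l, ⟨h1, h2, h3⟩, huniq⟩ := existsUnique_simple_inGraph S.tree_le S.isTree S.base v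
  have hpath := h1.isPath S.tree_le
  rw [← S.lift_eq] at hpath
  obtain ⟨m, hm, rfl⟩ := h.exists_lift hpath
  refine ⟨terminal S.lift m, ⟨⟨m, hm, rfl, h1, h2⟩, by rw [onV_terminal, S.lift_eq, h3]⟩, ?_⟩
  rintro s ⟨⟨m', hm', rfl, k1, k2⟩, k3⟩
  rw [onV_terminal, S.lift_eq] at k3
  rw [h.lift_unique hm' hm (huniq _ ⟨k1, k2, k3⟩)]

theorem eq_of_smul_eq (h : IsFreeGaloisCovering G π) (S : Choices π) {s s' : VY}
    (hs : s ∈ S.identitySheet) (hs' : s' ∈ S.identitySheet) {g g' : G}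
    (hg : g • s = g' • s') : g = g' ∧ s = s' := by
  have h1 : π.onV s = π.onV s' := by rw [← h.onV_smul g, hg, h.onV_smul]
  obtain rfl : s = s' := (S.existsUnique_mem_identitySheet h (π.onV s')).unique ⟨hs, h1⟩ ⟨hs', rfl⟩
  refine ⟨?_, rfl⟩
  have := h.isFreeAction.free_vertices (g'⁻¹ * g) s (by rw [mul_smul, hg, inv_smul_smul])
  exact (inv_mul_eq_one.1 this).symm

theorem exists_sheetNumber_smul (h : IsFreeGaloisCovering G π) (S : Choices π) (w : VY) :
    ∃ s ∈ S.identitySheet, S.sheetNumber G w • s = w := by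
  refine Classical.epsilon_spec (p := fun g : G => ∃ s ∈ S.identitySheet, g • s = w) ?_
  obtain ⟨s, ⟨hs, hsw⟩, -⟩ := S.existsUnique_mem_identitySheet h (π.onV w)
  obtain ⟨g, hg⟩ := h.onV_eq_iff.1 hsw
  exact ⟨g, s, hs, hg⟩

theorem sheetNumber_eq_one (h : IsFreeGaloisCovering G π) (S : Choices π) {s : VY}
    (hs : s ∈ S.identitySheet) : S.sheetNumber G s = 1 := by
  obtain ⟨s', hs', hw⟩ := S.exists_sheetNumber_smul (G := G) h s
  exact (S.eq_of_smul_eq h hs' hs (hw.trans (one_smul G s).symm)).1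

/-- The lift starts on the identity sheet and ends over the same vertex `v`, where the sheet has
only that one point; so the end is its translate by the sheet number. -/
theorem exists_terminal_eq_frobenius_smul (h : IsFreeGaloisCovering G π) (S : Choices π) {v : VX}
    {l : List (EX × VX)} (hl : X.IsPath v l) (hv : terminal v l = v) :
    ∃ w m, Y.IsPath w m ∧ π.onV w = v ∧ π.mapSteps m = l ∧
      terminal w m = S.frobenius G v l • w := by
  have hspec := Classical.epsilon_spec (p := fun g : G => ∃ (w : VY) (m : List (EY × VY)),
    Y.IsPath w m ∧ π.onV w = v ∧ π.mapSteps m = l ∧ S.sheetNumber G w = 1 ∧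
      S.sheetNumber G (terminal w m) = g) (by
    obtain ⟨s, ⟨hs, rfl⟩, -⟩ := S.existsUnique_mem_identitySheet h v
    obtain ⟨m, hm, hml⟩ := h.exists_lift hl
    exact ⟨_, s, m, hm, rfl, hml, S.sheetNumber_eq_one h hs, rfl⟩)
  obtain ⟨w, m, hm, rfl, rfl, hw, hg⟩ := hspec
  refine ⟨w, m, hm, rfl, rfl, ?_⟩
  obtain ⟨s, hs, hsw⟩ := S.exists_sheetNumber_smul (G := G) h w
  rw [hw, one_smul] at hsw
  obtain rfl := hsw
  obtain ⟨s', hs', hsw'⟩ := S.exists_sheetNumber_smul (G := G) h (terminal s m)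
  obtain rfl : s' = s := by
    refine (S.existsUnique_mem_identitySheet h (π.onV s)).unique ⟨hs', ?_⟩ ⟨hs, rfl⟩
    rw [← h.onV_smul (S.sheetNumber G (terminal s m)), hsw', onV_terminal, hv]
  refine hsw'.symm.trans (congrArg (· • s') hg)

/-- The Frobenius element of a prime cycle is a monodromy of its word. -/
theorem isMonodromy_frobenius (h : IsFreeGaloisCovering G π) (S : Choices π) {v : VX}
    {l : List (EX × VX)} (hl : X.IsPrimeCycle v l) :
    IsMonodromy G Y.Arrow (Prod.map π.onE π.onV) l (S.frobenius G v l) := by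
  obtain ⟨w, m, hm, rfl, rfl, hF⟩ := S.exists_terminal_eq_frobenius_smul h hl.1.1 hl.1.2.1
  obtain ⟨e, he⟩ := hl.exists_walk
  have hne : π.mapSteps m ≠ [] := by
    intro h0
    have := hl.1.2.2
    simp [h0] at this
  -- The lift starting at `w` is promoted to a walk on flags by lifting the preceding hyperedge too.
  -- Both lifts have the same steps, and freeness on vertices identifies the two group elements.
  obtain ⟨e, rfl, hwe⟩ := h.exists_edge (he.mem_flags_of_arrow hne)
  have hC := h.isWalkCovering
  have hflag : (e, w) ∈ Y.flags := hwe
  obtain ⟨m', b, hm', hb⟩ := hC.walk_lift (a := (e, w)) hflag he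
  obtain ⟨h1, -, h2⟩ := hb.isPath_of_arrow hflag
  obtain rfl : m' = m := h.lift_unique h1 hm hm'
  have hne' : m' ≠ [] := by
    rintro rfl
    exact hne rfl
  obtain ⟨g, rfl⟩ := hC.exists_smul (e, w) hflag b (hC.walk_end_mem hb hne')
    (he.unique_end (hm' ▸ hC.walk_map hb))
  refine ⟨(e, w), m', rfl, ?_⟩
  have h3 : g • w = S.frobenius G (π.onV w) (π.mapSteps m') • w := h2.symm.trans hF
  have h4 := h.isFreeAction.free_vertices ((S.frobenius G (π.onV w) (π.mapSteps m'))⁻¹ * g) w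
    (by rw [mul_smul, h3, inv_smul_smul])
  rw [inv_mul_eq_one.1 h4]
  exact hb

end Choices

end Frobenius

end MultiHypergraph

/-! ### Convergence of Euler products near the origin. -/

section Analysis

open Filter Topology

/-- The sum of `r ^ length` over all words in a finite alphabet converges for small `r`. -/
theorem summable_pow_length {α : Type*} [Fintype α] {r : ℝ} (hr : 0 ≤ r)
    (h : r * Fintype.card α < 1) : Summable fun l : List α => r ^ l.length := by
  rw [← (List.equivSigmaTuple (α := α)).symm.summable_iff]
  have hlen : ((fun l : List α => r ^ l.length) ∘ (List.equivSigmaTuple (α := α)).symm) =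
      fun x : Σ n, Fin n → α => r ^ x.1 := by
    funext x
    simp [List.equivSigmaTuple]
  rw [hlen, summable_sigma_of_nonneg fun _ => pow_nonneg hr _]
  refine ⟨fun n => Summable.of_finite, ?_⟩
  have : (fun n : ℕ => ∑' _ : Fin n → α, r ^ n) = fun n => (r * Fintype.card α) ^ n := by
    funext n
    rw [tsum_fintype, Finset.sum_const, Finset.card_univ, Fintype.card_fun, Fintype.card_fin,
      nsmul_eq_mul, Nat.cast_pow, mul_pow, mul_comm]
  rw [this]
  exact summable_geometric_of_lt_one (by positivity) h

/-- An Euler product over an index set with finitely many types of local factors converges near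
the origin. -/
theorem eventually_multipliable {ι A : Type*} [Finite A] {ℓ : ι → ℕ} (hℓ : ∀ c, 0 < ℓ c)
    (hsum : ∀ᶠ u : ℂ in 𝓝 0, Summable fun c => ‖u‖ ^ ℓ c) {φ : A → ℂ → ℂ}
    (h0 : ∀ a, φ a 0 = 1) (hφ : ∀ a, DifferentiableAt ℂ (φ a) 0) (s : ι → A) :
    ∀ᶠ u : ℂ in 𝓝 0, Multipliable fun c => φ (s c) (u ^ ℓ c) := by
  have hO : ∀ a, ∃ K : ℝ, 0 ≤ K ∧ ∀ᶠ t : ℂ in 𝓝 0, ‖φ a t - 1‖ ≤ K * ‖t‖ := fun a => by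
    obtain ⟨K, hK, hb⟩ := (hφ a).isBigO_sub.exists_nonneg
    refine ⟨K, hK, hb.bound.mono fun t ht => ?_⟩
    simpa [h0] using ht
  choose K hK hb using hO
  have := Fintype.ofFinite A
  obtain ⟨δ, hδ, hball⟩ := Metric.eventually_nhds_iff_ball.1 (eventually_all.2 hb)
  filter_upwards [hsum, Metric.ball_mem_nhds (0 : ℂ) hδ, Metric.ball_mem_nhds (0 : ℂ) one_pos]
    with u hu hu1 hu2
  rw [mem_ball_zero_iff] at hu1 hu2
  -- Finitely many types of factor allow one constant, the sum of all `K a`, and one radius `δ`.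
  have hbound : ∀ c, ‖φ (s c) (u ^ ℓ c) - 1‖ ≤ (∑ a, K a) * ‖u‖ ^ ℓ c := fun c => by
    have hmem : u ^ ℓ c ∈ Metric.ball (0 : ℂ) δ := by
      rw [mem_ball_zero_iff, norm_pow]
      exact (pow_le_of_le_one (norm_nonneg u) hu2.le (hℓ c).ne').trans_lt hu1
    refine (hball _ hmem (s c)).trans ?_
    rw [norm_pow]
    exact mul_le_mul_of_nonneg_right
      (Finset.single_le_sum (fun a _ => hK a) (Finset.mem_univ (s c))) (by positivity)
  have h1 : Summable fun c => ‖φ (s c) (u ^ ℓ c) - 1‖ :=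
    Summable.of_nonneg_of_le (fun _ => norm_nonneg _) hbound (hu.mul_left _)
  simpa using multipliable_one_add_of_summable h1

theorem LinearMap.differentiable_det_one_sub_smul {W : Type*} [AddCommGroup W] [Module ℂ W]
    [FiniteDimensional ℂ W] (f : W →ₗ[ℂ] W) :
    Differentiable ℂ fun t : ℂ => LinearMap.det (1 - t • f) := by
  let b := Module.finBasis ℂ W
  simp_rw [← LinearMap.det_toMatrix b, map_sub, map_smul, Matrix.det_apply]
  simp only [Matrix.sub_apply, Matrix.smul_apply]
  fun_prop

end Analysis

namespace MultiHypergraph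

/-! ### Classes of prime cycles and their Euler products. -/

section Classes

open Filter Topology

variable {V E : Type*} {H : MultiHypergraph V E}

theorem PrimeClass.length_eq (c : H.PrimeClass) (C : H.PrimeCycle)
    (h : Quotient.mk H.primeCycleSetoid C = c) : c.length = C.steps.length := by
  rw [← h]; rfl

theorem PrimeClass.length_pos (c : H.PrimeClass) : 0 < c.length := by
  induction c using Quotient.inductionOn with
  | h C => exact lt_trans one_pos C.isPrimeCycle.1.2.2

/-- Choosing representatives embeds the classes into words over the finite alphabet `E × V`, whose
length series converges for `‖u‖ * card < 1`. -/
theorem eventually_summable_pow_length (H : MultiHypergraph V E) :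
    ∀ᶠ u : ℂ in 𝓝 0, Summable fun c : H.PrimeClass => ‖u‖ ^ c.length := by
  have := H.finite_vertices
  have := H.finite_edges
  have := Fintype.ofFinite (E × V)
  have hcont : Continuous fun u : ℂ => ‖u‖ * Fintype.card (E × V) := by fun_prop
  have h := hcont.tendsto 0
  simp only [norm_zero, zero_mul] at h
  filter_upwards [h.eventually (gt_mem_nhds one_pos)] with u hu
  have hinj : Function.Injective fun c : H.PrimeClass => (Quotient.out c : H.PrimeCycle).steps := by
    intro c c' hcc
    rw [← Quotient.out_eq c, ← Quotient.out_eq c']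
    refine Quotient.sound ?_
    show (Quotient.out c : H.PrimeCycle).steps ~r (Quotient.out c' : H.PrimeCycle).steps
    rw [show (Quotient.out c : H.PrimeCycle).steps = (Quotient.out c' : H.PrimeCycle).steps
      from hcc]
  refine ((summable_pow_length (norm_nonneg u) hu).comp_injective hinj).congr fun c => ?_
  rw [Function.comp_apply, PrimeClass.length_eq c _ (Quotient.out_eq c)]

theorem eventually_multipliable_zetaFactor (H : MultiHypergraph V E) :
    ∀ᶠ u : ℂ in 𝓝 0, Multipliable (H.zetaFactor u) := by
  have h := eventually_multipliable (A := Unit) (φ := fun _ t => (1 - t)⁻¹)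
    PrimeClass.length_pos H.eventually_summable_pow_length (by simp)
    (fun _ => by
      refine DifferentiableAt.inv (by fun_prop) (by simp)) (fun _ => ())
  exact h

/-- The class of prime cycles of a prime word. -/
noncomputable def PrimeWord.primeClass {l : List (E × V)} (h : PrimeWord H.Arrow l) :
    H.PrimeClass :=
  Quotient.mk H.primeCycleSetoid ⟨h.isPrimeCycle.choose, l, h.isPrimeCycle.choose_spec⟩

theorem PrimeWord.primeClass_eq_iff {l l' : List (E × V)} (h : PrimeWord H.Arrow l)
    (h' : PrimeWord H.Arrow l') : h.primeClass = h'.primeClass ↔ l ~r l' :=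
  Quotient.eq

theorem PrimeWord.primeClass_eq_mk_iff {l : List (E × V)} (h : PrimeWord H.Arrow l)
    (C : H.PrimeCycle) :
    h.primeClass = Quotient.mk H.primeCycleSetoid C ↔ l ~r C.steps :=
  Quotient.eq

theorem PrimeWord.length_primeClass {l : List (E × V)} (h : PrimeWord H.Arrow l) :
    h.primeClass.length = l.length := rfl

/-- The type of a local factor is its Frobenius element, which ranges over the finite group `G`. -/
theorem Choices.eventually_multipliable_LFactor {VY EY VX EX G : Type*} [Group G]
    [MulAction G VY] [Finite G]
    {Y : MultiHypergraph VY EY} {X : MultiHypergraph VX EX} {π : Y.Hom X}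
    {W : Type*} [AddCommGroup W]
    [Module ℂ W] [FiniteDimensional ℂ W] (S : Choices π) (ρ : Representation ℂ G W) :
    ∀ᶠ u : ℂ in 𝓝 0, Multipliable (S.LFactor ρ u) :=
  eventually_multipliable (A := G) (φ := fun g t => (LinearMap.det (1 - t • ρ g))⁻¹)
    PrimeClass.length_pos X.eventually_summable_pow_length (by simp)
    (fun g => ((ρ g).differentiable_det_one_sub_smul 0).inv (by simp)) _

end Classes

/-! ### Splitting of primes and the factorization. -/

section Main

variable {VY EY VX EX G : Type*} [Group G] [MulAction G VY] [MulAction G EY]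
  {Y : MultiHypergraph VY EY} {X : MultiHypergraph VX EX} {π : Y.Hom X}

/-- The prime classes of the total space of a free Galois covering: those over a prime class `c`
of the base with monodromy `g` are in bijection with the cosets of the subgroup generated by `g`,
and their length is the product of the length of `c` and the order of `g`. -/
theorem IsFreeGaloisCovering.exists_primeClass_equiv (h : IsFreeGaloisCovering G π) :
    ∃ (γ : X.PrimeClass → G) (Ψ : (Σ c : X.PrimeClass, G ⧸ Subgroup.zpowers (γ c)) ≃ Y.PrimeClass),
      (∀ (c : X.PrimeClass) (C : X.PrimeCycle), Quotient.mk X.primeCycleSetoid C = c →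
        IsMonodromy G Y.Arrow (Prod.map π.onE π.onV) C.steps (γ c)) ∧
      ∀ x, (Ψ x).length = orderOf (γ x.1) * x.1.length := by
  have hC := h.isWalkCovering
  have := h.finite_group
  choose γ a m M d using fun c : X.PrimeClass =>
    hC.exists_primeLift (Quotient.out c : X.PrimeCycle).isPrimeCycle.primeWord
  have hout : ∀ c : X.PrimeClass,
      Quotient.mk X.primeCycleSetoid (Quotient.out c) = c := Quotient.out_eq
  have hrot : ∀ (c : X.PrimeClass) (C : X.PrimeCycle), Quotient.mk X.primeCycleSetoid C = c →
      (Quotient.out c : X.PrimeCycle).steps ~r C.steps := fun c C hc =>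
    Quotient.exact ((hout c).trans hc.symm)
  let ψ : (Σ c : X.PrimeClass, G ⧸ Subgroup.zpowers (γ c)) → Y.PrimeClass := fun x =>
    Quotient.lift (fun k : G => ((d x.1).primeWord_smul hC k).primeClass)
      (fun k k' hk => (PrimeWord.primeClass_eq_iff _ _).2
        (((d x.1).isRotated_iff hC k k').2 (Quotient.sound hk))) x.2
  have hψ : ∀ c (k : G), ψ ⟨c, (k : G ⧸ Subgroup.zpowers (γ c))⟩ =
      ((d c).primeWord_smul hC k).primeClass := fun _ _ => rfl
  have hbij : ψ.Bijective := by
    constructor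
    · rintro ⟨c, q⟩ ⟨c', q'⟩ hq
      induction q using QuotientGroup.induction_on with | H k => ?_
      induction q' using QuotientGroup.induction_on with | H k' => ?_
      rw [hψ, hψ, PrimeWord.primeClass_eq_iff] at hq
      obtain rfl : c = c' := by
        rw [← hout c, ← hout c']
        exact Quotient.sound ((d c).isRotated_base hC (d c') hq)
      rw [((d c).isRotated_iff hC k k').1 hq]
    · intro y
      induction y using Quotient.inductionOn with
      | h D =>
        have hD := D.isPrimeCycle.primeWord
        obtain ⟨b, hb⟩ := hD.1
        have hne : D.steps.map (Prod.map π.onE π.onV) ≠ [] := by simpa using hD.2.1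
        -- The prime of `X` below `D` is the primitive root of the projection of `D`.
        obtain ⟨w, n, hw, hn, hwn⟩ := exists_primitive_power hne
        have hcl := hC.walk_map hb
        rw [hwn] at hcl
        have hwp : PrimeWord X.Arrow w := ⟨⟨_, hcl.of_power hw.1 hn⟩, hw⟩
        have hwr : w ~r (Quotient.out hwp.primeClass : X.PrimeCycle).steps :=
          (PrimeWord.primeClass_eq_mk_iff hwp _).1 (hout _).symm
        obtain ⟨k, hk⟩ := (d hwp.primeClass).exists_isRotated hC hD hn hwn hwr
        refine ⟨⟨_, (k : G ⧸ Subgroup.zpowers (γ hwp.primeClass))⟩, ?_⟩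
        rw [hψ]
        exact (PrimeWord.primeClass_eq_mk_iff _ D).2 hk
  refine ⟨γ, Equiv.ofBijective ψ hbij, fun c C hc => ?_, ?_⟩
  · obtain ⟨r, hr⟩ := hrot c C hc
    rw [← hr]
    exact hC.isMonodromy_rotate (d c).isMonodromy r
  · rintro ⟨c, q⟩
    induction q using QuotientGroup.induction_on with | H k => ?_
    rw [Equiv.ofBijective_apply, hψ, PrimeWord.length_primeClass, List.length_map, (d c).length_eq,
      PrimeClass.length_eq c _ (hout c)]

theorem det_one_sub_smul_eq_of_isConj {W : Type*} [AddCommGroup W] [Module ℂ W]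
    (ρ : Representation ℂ G W) {g g' : G} (h : IsConj g g') (t : ℂ) :
    LinearMap.det (1 - t • ρ g) = LinearMap.det (1 - t • ρ g') := by
  obtain ⟨k, rfl⟩ := isConj_iff.1 h
  have h1 : ρ k * ρ k⁻¹ = 1 := by rw [← map_mul, mul_inv_cancel, map_one]
  have h2 : 1 - t • ρ (k * g * k⁻¹) = ρ k * (1 - t • ρ g) * ρ k⁻¹ := by
    rw [mul_sub, sub_mul, mul_one, h1, mul_smul_comm, smul_mul_assoc, map_mul, map_mul]
  rw [h2, map_mul, map_mul, mul_right_comm, ← map_mul, h1, map_one, one_mul]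

end Main

end MultiHypergraph

theorem mainTheorem3 {VY EY VX EX G ι : Type*} [Group G] [MulAction G VY] [MulAction G EY]
    {Y : MultiHypergraph VY EY} {X : MultiHypergraph VX EX} (π : Y.Hom X)
    (hY : Y.Connected) (hπ : MultiHypergraph.IsFreeGaloisCovering G π)
    [Fintype ι] {W : ι → Type*} [∀ i, AddCommGroup (W i)] [∀ i, Module ℂ (W i)]
    [∀ i, FiniteDimensional ℂ (W i)] (ρ : ∀ i, Representation ℂ G (W i))
    (hρ : IsCompleteSetOfIrreps ρ) (S : ι → MultiHypergraph.Choices π) :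
    ∃ R : ℝ, 0 < R ∧ ∀ u : ℂ, ‖u‖ < R →
      Multipliable (Y.zetaFactor u) ∧ (∀ i, Multipliable ((S i).LFactor (ρ i) u)) ∧
        Y.zeta u = ∏ i, (S i).LFunction (ρ i) u ^ Module.finrank ℂ (W i) := by
  have := hπ.finite_group
  obtain ⟨γ, Ψ, hγ, hlen⟩ := hπ.exists_primeClass_equiv
  obtain ⟨R, hR, hball⟩ := Metric.eventually_nhds_iff_ball.1
    (Y.eventually_multipliable_zetaFactor.and
      (Filter.eventually_all.2 fun i => (S i).eventually_multipliable_LFactor (ρ i)))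
  refine ⟨R, hR, fun u hu => ?_⟩
  obtain ⟨hζ, hL⟩ := hball u (by rwa [mem_ball_zero_iff])
  refine ⟨hζ, hL, ?_⟩
  have hlocal : ∀ c : X.PrimeClass,
      ∏ i, (S i).LFactor (ρ i) u c ^ Module.finrank ℂ (W i) =
        ∏' q : G ⧸ Subgroup.zpowers (γ c), Y.zetaFactor u (Ψ ⟨c, q⟩) := fun c => by
    have := Fintype.ofFinite (G ⧸ Subgroup.zpowers (γ c))
    -- The Frobenius elements vary with `i`, but each is conjugate to the common monodromy `γ c`, so
    -- all determinants can be taken at `γ c`.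
    have hfactor : ∀ i, (S i).LFactor (ρ i) u c =
        (LinearMap.det (1 - u ^ c.length • ρ i (γ c)))⁻¹ := fun i => by
      rw [MultiHypergraph.Choices.LFactor, MultiHypergraph.det_one_sub_smul_eq_of_isConj (ρ i)
        (hπ.isWalkCovering.isConj_of_isMonodromy ((S i).rep c).isPrimeCycle.primeWord.2.1
          ((S i).isMonodromy_frobenius hπ ((S i).rep c).isPrimeCycle)
          (hγ c ((S i).rep c) ((S i).rep_eq c)))]
    simp_rw [hfactor, inv_pow, Finset.prod_inv_distrib]
    rw [hρ.prod_det_pow_finrank, tprod_fintype]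
    simp_rw [MultiHypergraph.zetaFactor, hlen]
    rw [Finset.prod_const, Finset.card_univ, Nat.card_eq_fintype_card, inv_pow, ← pow_mul,
      mul_comm c.length]
  -- Unconditional convergence permits grouping the primes of `Y` by the prime of `X` below them.
  have hsigma : Y.zeta u = ∏' c : X.PrimeClass,
      ∏' q : G ⧸ Subgroup.zpowers (γ c), Y.zetaFactor u (Ψ ⟨c, q⟩) := by
    have h1 : HasProd (Y.zetaFactor u ∘ Ψ) (Y.zeta u) := Ψ.hasProd_iff.2 hζ.hasProd
    refine (h1.sigma fun c => ?_).tprod_eq.symm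
    exact Multipliable.hasProd Multipliable.of_finite
  rw [hsigma, ← tprod_congr hlocal, Multipliable.tprod_finsetProd fun i _ => (hL i).pow _]
  refine Finset.prod_congr rfl fun i _ => ?_
  rw [(hL i).tprod_pow]
  rfl
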